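/- Let $p\ge 3$ be an integer, $\omega_p=e^{2\pi i/p}$ and $f(z)=\sum_{k=0}^{p-1}\exp(\omega_p^k z)$. For integers $k$ let $R(k)=\{z\in\mathbb C:(2k-1)\pi<\operatorname{Im}z<(2k+1)\pi\}$. For $m\ge 1$ and $c>0$ let $T_{m,c}$ be the closed trapezium bounded by the lines $y=\tan(\pi/p)\,x$, $y=(2m-1)\pi$, $y=(2m+1)\pi$ and $x=c$, and let $T_{-m,c}$ be its reflection in the real axis. Given $M\ge 1$, $K\ge 0$ and $c$, put $T_j=T_{M+j-1,c}$ and $T_{-j}=T_{-(M+j-1),c}$ for $1\le j\le K$, let $T^K=\bigcup_{1\le|j|\le K}T_j$, and let $\Lambda_K$ be the set of points $z$ with $f^n(z)\in T^K$ for all $n\ge 0$. Let $\Sigma_K$ be the set of all sequences $s=s_0s_1s_2\ldots$ of integers with $1\le|s_i|\le K$, with the shift map $\sigma(s_0s_1s_2\ldots)=s_1s_2s_3\ldots$. A point $z$ has itinerary $s\in\Sigma_K$ if, for every $n\ge 0$, $f^n(z)$ lies in the strip labelled by $s_n$, where the label $j\in\{1,\dots,K\}$ stands for $R(M+j-1)$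 and the label $-j$ for $R(-(M+j-1))$ (the open strips whose closures contain $T_j$ and $T_{-j}$). The Julia set $J(f)$ is the complement of the set of points that have a neighbourhood on which the iterates $(f^n)$ form a normal family. For all sufficiently large $M$ (depending on $p$), all $K$, and all sufficiently large $c$ (depending on $p,M,K$), the following holds. For each $s\in\Sigma_K$ there is a unique point $z(s)\in\Lambda_K$ with itinerary $s$, and: (a) if $s=\overline{s_0s_1\cdots s_{n-1}}$ is a repeating sequence, i.e. $\sigma^n(s)=s$ with $n\ge1$, then $z(s)$ is a repelling periodic point of $f$ with period $n$, that is, $f^n(z(s))=z(s)$ and $|(f^n)'(z(s))|>1$; moreover the least period of $z(s)$ under $f$ equals the least period of $s$ under $\sigma$; (b) for every $s\in\Sigma_K$ (repeating or not), $z(s)\in J(f)$. -/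

import Mathlib

namespace ExpSum

noncomputable section

/-- The `p`-th root of unity `exp (2 π i / p)`. -/
def omega (p : ℕ) : ℂ := Complex.exp (2 * Real.pi * Complex.I / p)

/-- The entire function `f z = ∑ k < p, exp (ω_p ^ k * z)`. -/
def expSum (p : ℕ) (z : ℂ) : ℂ := ∑ k ∈ Finset.range p, Complex.exp (omega p ^ k * z)

/-- A sequence `F` of maps is normal on `U`: every sequence taken from the family has a subsequence
that converges locally uniformly on `U`, either to a finite function or to `∞`. -/
def IsNormalOn (F : ℕ → ℂ → ℂ) (U : Set ℂ) : Prop :=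
  ∀ φ : ℕ → ℕ, ∃ ψ : ℕ → ℕ, StrictMono ψ ∧
    ((∃ g : ℂ → ℂ, TendstoLocallyUniformlyOn (fun k => F (φ (ψ k))) g Filter.atTop U) ∨
      (∀ C : Set ℂ, C ⊆ U → IsCompact C → ∀ r : ℝ, ∀ᶠ k in Filter.atTop,
        ∀ z ∈ C, r < ‖F (φ (ψ k)) z‖))

/-- The Fatou set: points having a connected open neighbourhood on which the iterates
form a normal family. -/
def fatouSet (f : ℂ → ℂ) : Set ℂ :=
  {z | ∃ U : Set ℂ, IsOpen U ∧ IsConnected U ∧ z ∈ U ∧ IsNormalOn (fun n => f^[n]) U}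

/-- The Julia set: the complement of the Fatou set. -/
def juliaSet (f : ℂ → ℂ) : Set ℂ := (fatouSet f)ᶜ

/-- `z` is a repelling periodic point of `f`, `n ≥ 1` being a (not necessarily least) period:
`f^n z = z` and the multiplier `(f^n)' z` has modulus greater than `1`. -/
def IsRepellingPeriodicPt (f : ℂ → ℂ) (n : ℕ) (z : ℂ) : Prop :=
  0 < n ∧ Function.IsPeriodicPt f n z ∧ 1 < ‖deriv f^[n] z‖

/-- The open horizontal strip `R(k)`. -/
def strip (k : ℤ) : Set ℂ :=
  {z | (2 * (k : ℝ) - 1) * Real.pi < z.im ∧ z.im < (2 * (k : ℝ) + 1) * Real.pi}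

/-- The closed trapezium `T_{m,c}` bounded by the lines `y = tan (π / p) x`, `y = (2 m - 1) π`,
`y = (2 m + 1) π` and `x = c`. -/
def trapezium (p m : ℕ) (c : ℝ) : Set ℂ :=
  {z | (2 * (m : ℝ) - 1) * Real.pi ≤ z.im ∧ z.im ≤ (2 * (m : ℝ) + 1) * Real.pi ∧
    z.im ≤ Real.tan (Real.pi / p) * z.re ∧ z.re ≤ c}

/-- The union `T^K` of the trapeziums `T_{m,c}`, `M ≤ m ≤ M + K - 1`, and of their reflections
`T_{-m,c}` in the real axis. -/
def trapeziumUnion (p M K : ℕ) (c : ℝ) : Set ℂ :=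
  {z | ∃ m : ℕ, M ≤ m ∧ m < M + K ∧
    (z ∈ trapezium p m c ∨ (starRingEnd ℂ) z ∈ trapezium p m c)}

/-- The set `Λ_K` of points whose whole forward orbit stays in `T^K`. -/
def invariantSet (p M K : ℕ) (c : ℝ) : Set ℂ :=
  {z | ∀ n : ℕ, (expSum p)^[n] z ∈ trapeziumUnion p M K c}

/-- The sequences over the alphabet `{±1, …, ±K}`. -/
def symbolSpace (K : ℕ) : Set (ℕ → ℤ) := {s | ∀ i, 1 ≤ |s i| ∧ |s i| ≤ (K : ℤ)}

/-- The one-sided shift map. -/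
def shift (s : ℕ → ℤ) : ℕ → ℤ := fun i => s (i + 1)

/-- The number of the strip that carries the symbol `j`: the symbols `1, …, K` label the strips
`R(M), …, R(M + K - 1)` and the symbols `-1, …, -K` the strips `R(-M), …, R(-(M + K - 1))`. -/
def stripIndex (M : ℕ) (j : ℤ) : ℤ := if 0 < j then j + (M - 1) else j - (M - 1)

/-- `z` has the itinerary `s` under `f`: each `f^n z` lies in the strip labelled by `s_n`. -/
def HasItinerary (p M : ℕ) (s : ℕ → ℤ) (z : ℂ) : Prop :=
  ∀ n : ℕ, (expSum p)^[n] z ∈ strip (stripIndex M (s n))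

end

end ExpSum

open ExpSum

open Filter Topology

namespace ExpSum

/-! The mechanism is a Markov-type coding by expanding inverse branches. Let S be a half-strip of
height 2π, cut out of R(m) by the ray arg z = π/p, with m large. On its horizontal edges Re f < 0
(`exists_forall_re_expSum_neg`), and on its oblique edge f is real (`im_expSum_eq_zero`). So no
boundary point of S is mapped into an open quadrant of the right half-plane. Since f is close to exp
far to the right in S, it is proper over each quadrant. It has no critical point in S
(`exists_forall_expSumDeriv_ne_zero`), and some value far out is taken exactly once
(`exists_base_point`). By connectedness every value in the quadrant is taken exactly once
(`existsUnique_of_proper`), so there is a holomorphic inverse branch from the quadrant to S.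

The branch takes values in a strip of height 2π, so by Borel–Carathéodory its derivative at a point
of depth d in the quadrant is at most 8π/d (`norm_deriv_le_of_mapsTo_strip`). Points of the trapezia
have depth at least Mπ/2, and for M ≥ 32 the branches therefore contract by 1/2 there. Conjugation
carries everything to the lower half-plane.

Pulling back along a finite word gives points following that word; they stay left of x = c because
|f| is huge beyond that line. Compactness yields a point for every infinite sequence
(`exists_followsTrapezia`), and contraction makes it unique (`FollowsTrapezia.eq`). Uniqueness turns
periods of the sequence into periods of the point. Along the orbit |(fⁿ)'| ≥ 2ⁿ while the orbit is
bounded, which gives repulsion and excludes normality. -/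

/-! ### Roots of unity and the symmetries of f and f'. -/

lemma omega_pow_eq (p k : ℕ) :
    omega p ^ k = Complex.exp (((2 * k * (Real.pi / p) : ℝ) : ℂ) * Complex.I) := by
  rw [omega, ← Complex.exp_nat_mul]
  congr 1
  push_cast
  ring

lemma omega_pow_self {p : ℕ} (hp : p ≠ 0) : omega p ^ p = 1 := by
  have hp' : (p : ℂ) ≠ 0 := by exact_mod_cast hp
  rw [omega, ← Complex.exp_nat_mul, ← Complex.exp_two_pi_mul_I]
  congr 1
  field_simp

lemma norm_omega_pow (p k : ℕ) : ‖omega p ^ k‖ = 1 := by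
  rw [omega_pow_eq, Complex.norm_exp_ofReal_mul_I]

lemma conj_omega_pow {p k l : ℕ} (hp : p ≠ 0) (h : k + l = p) :
    (starRingEnd ℂ) (omega p ^ k) = omega p ^ l := by
  have h1 : omega p ^ k * omega p ^ l = 1 := by rw [← pow_add, h, omega_pow_self hp]
  have h2 : omega p ^ k * (starRingEnd ℂ) (omega p ^ k) = 1 := by
    rw [Complex.mul_conj, Complex.normSq_eq_norm_sq, norm_omega_pow]
    simp
  have h3 : omega p ^ k ≠ 0 := by
    intro h0
    simp [h0] at h1
  exact mul_left_cancel₀ h3 (h2.trans h1.symm)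

lemma re_omega_pow_mul (p k : ℕ) (z : ℂ) :
    (omega p ^ k * z).re =
      Real.cos (2 * k * (Real.pi / p)) * z.re - Real.sin (2 * k * (Real.pi / p)) * z.im := by
  rw [omega_pow_eq, Complex.mul_re, Complex.exp_ofReal_mul_I_re, Complex.exp_ofReal_mul_I_im]

lemma im_omega_pow_mul (p k : ℕ) (z : ℂ) :
    (omega p ^ k * z).im =
      Real.cos (2 * k * (Real.pi / p)) * z.im + Real.sin (2 * k * (Real.pi / p)) * z.re := by
  rw [omega_pow_eq, Complex.mul_im, Complex.exp_ofReal_mul_I_re, Complex.exp_ofReal_mul_I_im]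

/-- The derivative of `expSum p`. -/
noncomputable def expSumDeriv (p : ℕ) (z : ℂ) : ℂ :=
  ∑ k ∈ Finset.range p, omega p ^ k * Complex.exp (omega p ^ k * z)

lemma hasDerivAt_expSum (p : ℕ) (z : ℂ) : HasDerivAt (expSum p) (expSumDeriv p z) z := by
  have h : ∀ k ∈ Finset.range p, HasDerivAt (fun z => Complex.exp (omega p ^ k * z))
      (omega p ^ k * Complex.exp (omega p ^ k * z)) z := by
    intro k _
    have := ((hasDerivAt_id z).const_mul (omega p ^ k)).cexp
    simpa [mul_comm] using this
  exact HasDerivAt.fun_sum h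

lemma differentiable_expSum (p : ℕ) : Differentiable ℂ (expSum p) :=
  fun z => (hasDerivAt_expSum p z).differentiableAt

lemma deriv_expSum (p : ℕ) : deriv (expSum p) = expSumDeriv p :=
  funext fun z => (hasDerivAt_expSum p z).deriv

lemma sum_range_comp_sub {p : ℕ} (F : ℕ → ℂ) (hF : F p = F 0) :
    ∑ k ∈ Finset.range p, F (p - k) = ∑ k ∈ Finset.range p, F k := by
  have h1 : ∑ k ∈ Finset.range (p + 1), F (p - k) = ∑ k ∈ Finset.range (p + 1), F k := by
    have := Finset.sum_range_reflect F (p + 1)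
    simpa using this
  rw [Finset.sum_range_succ, Finset.sum_range_succ] at h1
  simp only [Nat.sub_self, hF] at h1
  exact add_right_cancel h1

lemma expSum_conj {p : ℕ} (hp : p ≠ 0) (z : ℂ) :
    expSum p ((starRingEnd ℂ) z) = (starRingEnd ℂ) (expSum p z) := by
  have h := sum_range_comp_sub (p := p) (fun k => Complex.exp (omega p ^ k * (starRingEnd ℂ) z))
    (by simp [omega_pow_self hp])
  rw [expSum, ← h, expSum, map_sum]
  refine Finset.sum_congr rfl fun k hk => ?_
  rw [← Complex.exp_conj, map_mul,
    conj_omega_pow hp (Nat.add_sub_cancel' (Finset.mem_range.1 hk).le)]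

lemma expSum_omega_mul {p : ℕ} (hp : p ≠ 0) (z : ℂ) : expSum p (omega p * z) = expSum p z := by
  have h1 := Finset.sum_range_succ (fun k => Complex.exp (omega p ^ k * z)) p
  have h2 := Finset.sum_range_succ' (fun k => Complex.exp (omega p ^ k * z)) p
  rw [h1] at h2
  simp only [omega_pow_self hp, pow_zero] at h2
  have h3 := add_right_cancel h2
  rw [expSum, expSum, h3]
  refine Finset.sum_congr rfl fun k _ => ?_
  rw [pow_succ, mul_assoc]

lemma expSumDeriv_conj {p : ℕ} (hp : p ≠ 0) (z : ℂ) :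
    expSumDeriv p ((starRingEnd ℂ) z) = (starRingEnd ℂ) (expSumDeriv p z) := by
  have h := sum_range_comp_sub (p := p)
    (fun k => omega p ^ k * Complex.exp (omega p ^ k * (starRingEnd ℂ) z))
    (by simp [omega_pow_self hp])
  rw [expSumDeriv, ← h, expSumDeriv, map_sum]
  refine Finset.sum_congr rfl fun k hk => ?_
  rw [map_mul, ← Complex.exp_conj, map_mul,
    conj_omega_pow hp (Nat.add_sub_cancel' (Finset.mem_range.1 hk).le)]

lemma omega_mul_expSumDeriv_omega_mul {p : ℕ} (hp : p ≠ 0) (z : ℂ) :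
    omega p * expSumDeriv p (omega p * z) = expSumDeriv p z := by
  have h1 := Finset.sum_range_succ (fun k => omega p ^ k * Complex.exp (omega p ^ k * z)) p
  have h2 := Finset.sum_range_succ' (fun k => omega p ^ k * Complex.exp (omega p ^ k * z)) p
  rw [h1] at h2
  simp only [omega_pow_self hp, pow_zero] at h2
  have h3 := add_right_cancel h2
  rw [expSumDeriv, expSumDeriv, h3, Finset.mul_sum]
  refine Finset.sum_congr rfl fun k _ => ?_
  rw [pow_succ]
  ring_nf

/-! ### Dominant exponents in the sector 0 ≤ arg z ≤ π/p. -/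

/-- The gap between the two dominant exponents and the other ones. -/
noncomputable def gap (p : ℕ) : ℝ := Real.cos (Real.pi / p) - Real.cos (2 * (Real.pi / p))

lemma angle_pos {p : ℕ} (hp : 3 ≤ p) : 0 < Real.pi / p := by
  have : (0 : ℝ) < p := by exact_mod_cast (by omega : 0 < p)
  exact div_pos Real.pi_pos this

lemma angle_le {p : ℕ} (hp : 3 ≤ p) : Real.pi / p ≤ Real.pi / 3 := by
  have : (3 : ℝ) ≤ p := by exact_mod_cast hp
  exact div_le_div_of_nonneg_left Real.pi_pos.le (by norm_num) this

lemma sin_angle_pos {p : ℕ} (hp : 3 ≤ p) : 0 < Real.sin (Real.pi / p) :=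
  Real.sin_pos_of_pos_of_lt_pi (angle_pos hp) (by linarith [angle_le hp, Real.pi_pos])

lemma cos_angle_ge {p : ℕ} (hp : 3 ≤ p) : 1 / 2 ≤ Real.cos (Real.pi / p) := by
  rw [← Real.cos_pi_div_three]
  exact Real.cos_le_cos_of_nonneg_of_le_pi (angle_pos hp).le (by linarith [Real.pi_pos])
    (angle_le hp)

lemma gap_pos {p : ℕ} (hp : 3 ≤ p) : 0 < gap p := by
  have := Real.cos_lt_cos_of_nonneg_of_le_pi (x := Real.pi / p) (y := 2 * (Real.pi / p))
    (angle_pos hp).le (by linarith [angle_le hp, Real.pi_pos]) (by linarith [angle_pos hp])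
  unfold gap
  linarith

lemma cos_le_cos_of_mem {a t : ℝ} (ha : 0 ≤ a) (h1 : a ≤ t) (h2 : t ≤ 2 * Real.pi - a) :
    Real.cos t ≤ Real.cos a := by
  rcases le_total t Real.pi with h | h
  · exact Real.cos_le_cos_of_nonneg_of_le_pi ha h h1
  · rw [← Real.cos_two_pi_sub t]
    exact Real.cos_le_cos_of_nonneg_of_le_pi ha (by linarith) (by linarith)

/-- In the sector `0 ≤ arg z ≤ π / p` all the exponents but the first and the last one are
dominated by the first one. -/
lemma re_omega_pow_mul_le {p : ℕ} (hp : 3 ≤ p) {z : ℂ} (h0 : 0 ≤ z.im)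
    (h1 : z.im * Real.cos (Real.pi / p) ≤ z.re * Real.sin (Real.pi / p)) {k : ℕ} (hk : 1 ≤ k)
    (hk' : k + 2 ≤ p) : (omega p ^ k * z).re ≤ z.re - gap p * ‖z‖ := by
  set b := Real.pi / p with hb
  have hs := sin_angle_pos hp
  have hc := cos_angle_ge hp
  have hbp := angle_pos hp
  rw [← hb] at hs hc hbp
  -- Oblique coordinates z = t + u·exp(ib) with t, u ≥ 0 along the two edges of the sector. The
  -- inequality is linear in them, so it is enough to compare cosines on each edge.
  obtain ⟨u, hu⟩ : ∃ u, u = z.im / Real.sin b := ⟨_, rfl⟩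
  obtain ⟨t, ht⟩ : ∃ t, t = z.re - u * Real.cos b := ⟨_, rfl⟩
  have hu0 : 0 ≤ u := hu ▸ div_nonneg h0 hs.le
  have him : z.im = u * Real.sin b := by rw [hu]; field_simp
  have hre : z.re = t + u * Real.cos b := by rw [ht]; ring
  have ht0 : 0 ≤ t := by
    have : 0 ≤ t * Real.sin b := by rw [him, hre] at h1; nlinarith
    exact nonneg_of_mul_nonneg_left this hs
  have hk1 : (1 : ℝ) ≤ k := by exact_mod_cast hk
  have hk2 : (k : ℝ) + 2 ≤ p := by exact_mod_cast hk'
  have hpb : (p : ℝ) * b = Real.pi := by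
    have : (p : ℝ) ≠ 0 := by exact_mod_cast (by omega : p ≠ 0)
    rw [hb]; field_simp
  have hkb : (k : ℝ) * b + 2 * b ≤ Real.pi := by nlinarith
  have hkb' : b ≤ k * b := by nlinarith
  have c1 : Real.cos (2 * k * b) ≤ Real.cos (2 * b) :=
    cos_le_cos_of_mem (by linarith) (by linarith) (by linarith)
  have c2 : Real.cos (2 * k * b + b) ≤ Real.cos (2 * b) :=
    cos_le_cos_of_mem (by linarith) (by linarith) (by linarith)
  have hn : ‖z‖ ≤ t + u := by
    have hz : z = t + u * Complex.exp (b * Complex.I) := by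
      apply Complex.ext
      · simp [Complex.exp_ofReal_mul_I_re, hre]
      · simp [Complex.exp_ofReal_mul_I_im, him]
    calc ‖z‖ = ‖(t : ℂ) + u * Complex.exp (b * Complex.I)‖ := by rw [← hz]
      _ ≤ ‖(t : ℂ)‖ + ‖(u : ℂ) * Complex.exp (b * Complex.I)‖ := norm_add_le _ _
      _ = t + u := by
        rw [norm_mul, Complex.norm_exp_ofReal_mul_I, Complex.norm_real, Complex.norm_real,
          Real.norm_of_nonneg ht0, Real.norm_of_nonneg hu0, mul_one]
  have hg := gap_pos hp
  have hgn : gap p * ‖z‖ ≤ gap p * (t + u) := by gcongr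
  have e : (omega p ^ k * z).re = t * Real.cos (2 * k * b) + u * Real.cos (2 * k * b + b) := by
    rw [re_omega_pow_mul, Real.cos_add, ← hb, hre, him]
    ring
  have hgd : gap p = Real.cos b - Real.cos (2 * b) := rfl
  rw [e, hre]
  have hc1 : Real.cos b ≤ 1 := Real.cos_le_one b
  rw [hgd] at hgn ⊢
  nlinarith [mul_le_mul_of_nonneg_left c1 ht0, mul_le_mul_of_nonneg_left c2 hu0,
    mul_le_mul_of_nonneg_left hc1 ht0]

lemma re_omega_pow_pred_mul {p : ℕ} (hp : 3 ≤ p) (z : ℂ) :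
    (omega p ^ (p - 1) * z).re = z.re - 2 * Real.sin (Real.pi / p) *
      (z.re * Real.sin (Real.pi / p) - z.im * Real.cos (Real.pi / p)) := by
  have hpb : (p : ℝ) * (Real.pi / p) = Real.pi := by
    have : (p : ℝ) ≠ 0 := by exact_mod_cast (by omega : p ≠ 0)
    field_simp
  have h : 2 * ((p - 1 : ℕ) : ℝ) * (Real.pi / p) = 2 * Real.pi - 2 * (Real.pi / p) := by
    rw [Nat.cast_sub (by omega)]
    push_cast
    linear_combination 2 * hpb
  rw [re_omega_pow_mul, h, Real.cos_two_pi_sub, Real.sin_two_pi_sub, Real.cos_two_mul,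
    Real.sin_two_mul, ← Real.cos_sq_add_sin_sq (Real.pi / p)] 
  have := Real.cos_sq_add_sin_sq (Real.pi / p)
  linear_combination z.re * this

/-! ### Absence of critical points in the open sector. -/

lemma norm_exp_sub_exp_le {A B : ℂ} {R : ℝ} (hA : A.re ≤ R) (hB : B.re ≤ R) :
    ‖Complex.exp A - Complex.exp B‖ ≤ Real.exp R * ‖A - B‖ := by
  refine (convex_halfSpace_re_le R).norm_image_sub_le_of_norm_deriv_le
    (fun x _ => Complex.differentiableAt_exp) (fun x hx => ?_) hB hA
  rw [Complex.deriv_exp, Complex.norm_exp]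
  exact Real.exp_le_exp.2 hx

/-- Exponential decay beats a linear factor. The factor 1 + 4r is the one lost when 1 - exp(-x) is
bounded below by x / (1 + x) in the critical point estimate. -/
lemma exists_forall_exp_lt {p : ℕ} (hp : 3 ≤ p) {C η : ℝ} (hη : 0 < η) :
    ∃ r₀ : ℝ, ∀ r, r₀ ≤ r → C * (1 + 4 * r) * Real.exp (-(gap p * r)) < η := by
  have hg := gap_pos hp
  have h1 : Tendsto (fun r : ℝ => Real.exp (-(gap p * r))) atTop (𝓝 0) :=
    Real.tendsto_exp_neg_atTop_nhds_zero.comp (tendsto_id.const_mul_atTop hg)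
  have h2 : Tendsto (fun r : ℝ => (gap p * r) * Real.exp (-(gap p * r))) atTop (𝓝 0) := by
    have := (Real.tendsto_pow_mul_exp_neg_atTop_nhds_zero 1).comp
      (tendsto_id.const_mul_atTop hg)
    simpa [Function.comp_def] using this
  have h3 : Tendsto (fun r : ℝ => C * (1 + 4 * r) * Real.exp (-(gap p * r))) atTop (𝓝 0) := by
    have := (h1.const_mul C).add (h2.const_mul (4 * C / gap p))
    simp only [mul_zero, add_zero] at this
    refine this.congr fun r => ?_
    field_simp
  obtain ⟨r₀, h⟩ := eventually_atTop.1 (h3.eventually_lt_const hη)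
  exact ⟨r₀, h⟩

/-- Conjugating the second summand replaces the index j by p - 1 - j. Unless both i and p - 1 - j
are extreme, one of them is a non-dominant exponent and loses `gap p * ‖z‖`. -/
lemma re_le_re_sub_of_ne {p : ℕ} (hp : 3 ≤ p) {z : ℂ} (h0 : 0 ≤ z.im)
    (h1 : z.im * Real.cos (Real.pi / p) ≤ z.re * Real.sin (Real.pi / p)) {i j : ℕ}
    (hi : i < p) (hj : j < p) (hij : i ≠ j) (h : (i, j) ≠ (0, p - 1)) (h' : (i, j) ≠ (p - 1, 0)) :
    (omega p ^ i * z + omega p ^ j * (omega p * (starRingEnd ℂ) z)).re ≤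
      2 * z.re - gap p * ‖z‖ := by
  have hle : ∀ k, k < p → (omega p ^ k * z).re ≤ z.re := by
    intro k hk
    rcases Nat.eq_zero_or_pos k with rfl | hk0
    · simp
    · by_cases hk2 : k + 2 ≤ p
      · have := re_omega_pow_mul_le hp h0 h1 hk0 hk2
        nlinarith [gap_pos hp, norm_nonneg z]
      · obtain rfl : k = p - 1 := by omega
        rw [re_omega_pow_pred_mul hp]
        nlinarith [sin_angle_pos hp]
  have hconj : (omega p ^ j * (omega p * (starRingEnd ℂ) z)).re = (omega p ^ (p - 1 - j) * z).re := by
    rw [← mul_assoc, ← pow_succ, ← Complex.conj_re, map_mul, Complex.conj_conj,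
      conj_omega_pow (l := p - 1 - j) (by omega) (by omega)]
  rw [Complex.add_re, hconj]
  have hcase : (1 ≤ i ∧ i + 2 ≤ p) ∨ (1 ≤ p - 1 - j ∧ p - 1 - j + 2 ≤ p) := by
    simp only [ne_eq, Prod.mk.injEq, not_and] at h h'
    omega
  rcases hcase with ⟨a, b⟩ | ⟨a, b⟩
  · linarith [re_omega_pow_mul_le hp h0 h1 a b, hle (p - 1 - j) (by omega)]
  · linarith [re_omega_pow_mul_le hp h0 h1 a b, hle i hi]

/-- Far from the origin, the derivative has no zeros in the open sector
`0 ≤ arg z < π / p`. -/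
lemma exists_forall_expSumDeriv_ne_zero {p : ℕ} (hp : 3 ≤ p) :
    ∃ r₀ : ℝ, ∀ z : ℂ, r₀ ≤ ‖z‖ → 0 ≤ z.im →
      z.im * Real.cos (Real.pi / p) < z.re * Real.sin (Real.pi / p) → expSumDeriv p z ≠ 0 := by
  have hs := sin_angle_pos hp
  obtain ⟨r₀, hr₀⟩ := exists_forall_exp_lt hp (C := (p : ℝ) ^ 2)
    (η := Real.sin (Real.pi / p) ^ 2) (by positivity)
  refine ⟨r₀, fun z hz h0 h1 hD => ?_⟩
  have hp0 : p ≠ 0 := by omega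
  -- w is the mirror image of z in the line arg = π/p, and by symmetry it is a critical point too.
  -- Near this line the two dominant exponentials have almost equal modulus, so a direct comparison
  -- fails; comparing z with w gives estimates that carry a common factor v, the distance of z to
  -- the line.
  set w := omega p * (starRingEnd ℂ) z with hw
  have hDw : expSumDeriv p w = 0 := by
    have h := omega_mul_expSumDeriv_omega_mul hp0 ((starRingEnd ℂ) z)
    rw [expSumDeriv_conj hp0, hD, map_zero, mul_eq_zero] at h
    exact h.resolve_left (by simp [omega])
  set v := z.re * Real.sin (Real.pi / p) - z.im * Real.cos (Real.pi / p) with hv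
  have hv0 : 0 < v := by rw [hv]; linarith
  set A : ℕ → ℕ → ℂ := fun i j => omega p ^ i * z + omega p ^ j * w with hA
  -- Antisymmetrised terms of 2(f'(z)f(w) - f(z)f'(w)), which vanishes as z and w are both critical.
  -- The differences of exponentials make each term small with z - w.
  set E : ℕ × ℕ → ℂ := fun q => (omega p ^ q.1 - omega p ^ q.2) *
    (Complex.exp (A q.1 q.2) - Complex.exp (A q.2 q.1)) with hE
  have hsum : ∑ q ∈ Finset.range p ×ˢ Finset.range p, E q = 0 := by
    have hprod : ∀ F G : ℕ → ℂ, ∑ q ∈ Finset.range p ×ˢ Finset.range p, F q.1 * G q.2 =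
        (∑ i ∈ Finset.range p, F i) * ∑ j ∈ Finset.range p, G j := by
      intro F G
      rw [Finset.sum_product, Finset.sum_mul_sum]
    have e : ∀ q : ℕ × ℕ, E q =
        (omega p ^ q.1 * Complex.exp (omega p ^ q.1 * z)) * Complex.exp (omega p ^ q.2 * w)
        - Complex.exp (omega p ^ q.1 * z) * (omega p ^ q.2 * Complex.exp (omega p ^ q.2 * w))
        - (omega p ^ q.1 * Complex.exp (omega p ^ q.1 * w)) * Complex.exp (omega p ^ q.2 * z)
        + Complex.exp (omega p ^ q.1 * w) * (omega p ^ q.2 * Complex.exp (omega p ^ q.2 * z)) := by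
      intro q
      simp only [hE, hA, Complex.exp_add]
      ring
    simp only [e, Finset.sum_add_distrib, Finset.sum_sub_distrib]
    rw [hprod (fun i => omega p ^ i * Complex.exp (omega p ^ i * z))
        (fun j => Complex.exp (omega p ^ j * w)),
      hprod (fun i => Complex.exp (omega p ^ i * z))
        (fun j => omega p ^ j * Complex.exp (omega p ^ j * w)),
      hprod (fun i => omega p ^ i * Complex.exp (omega p ^ i * w))
        (fun j => Complex.exp (omega p ^ j * z)),
      hprod (fun i => Complex.exp (omega p ^ i * w))
        (fun j => omega p ^ j * Complex.exp (omega p ^ j * z))]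
    have h1 : ∑ i ∈ Finset.range p, omega p ^ i * Complex.exp (omega p ^ i * z) = 0 := hD
    have h2 : ∑ i ∈ Finset.range p, omega p ^ i * Complex.exp (omega p ^ i * w) = 0 := hDw
    rw [h1, h2]
    ring
  have hzw : z - w = Complex.exp ((Real.pi / p : ℝ) * Complex.I) * (((-2 * v : ℝ) : ℂ) * Complex.I) := by
    have hω : omega p = Complex.exp ((2 * (Real.pi / p) : ℝ) * Complex.I) := by
      have := omega_pow_eq p 1
      simpa using this
    have hcs := Real.cos_sq_add_sin_sq (Real.pi / p)
    rw [hw, hω]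
    apply Complex.ext
    · rw [Complex.sub_re, Complex.mul_re, Complex.mul_re, Complex.exp_ofReal_mul_I_re,
        Complex.exp_ofReal_mul_I_im, Complex.exp_ofReal_mul_I_re, Complex.exp_ofReal_mul_I_im,
        Real.cos_two_mul, Real.sin_two_mul]
      simp only [Complex.conj_re, Complex.conj_im, Complex.re_ofReal_mul, Complex.im_ofReal_mul,
        Complex.I_re, Complex.I_im, hv]
      linear_combination (-2 * z.re) * hcs
    · rw [Complex.sub_im, Complex.mul_im, Complex.mul_im, Complex.exp_ofReal_mul_I_re,
        Complex.exp_ofReal_mul_I_im, Complex.exp_ofReal_mul_I_re, Complex.exp_ofReal_mul_I_im,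
        Real.cos_two_mul, Real.sin_two_mul]
      simp only [Complex.conj_re, Complex.conj_im, Complex.re_ofReal_mul, Complex.im_ofReal_mul,
        Complex.I_re, Complex.I_im, hv]
      ring
  have hzw' : ‖z - w‖ = 2 * v := by
    rw [hzw, norm_mul, Complex.norm_exp_ofReal_mul_I]
    rw [norm_mul, Complex.norm_real, Complex.norm_I, Real.norm_eq_abs, abs_mul, abs_of_pos hv0]
    norm_num
  have hbound : ∀ q ∈ ((Finset.range p ×ˢ Finset.range p).erase (0, p - 1)).erase (p - 1, 0),
      ‖E q‖ ≤ 8 * v * Real.exp (2 * z.re - gap p * ‖z‖) := by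
    rintro ⟨i, j⟩ hq
    simp only [Finset.mem_erase, Finset.mem_product, Finset.mem_range] at hq
    obtain ⟨hq1, hq2, hi, hj⟩ := hq
    have hω2 : ‖omega p ^ i - omega p ^ j‖ ≤ 2 := by
      refine (norm_sub_le _ _).trans ?_
      rw [norm_omega_pow, norm_omega_pow]
      norm_num
    by_cases hij : i = j
    · subst hij
      simp only [hE, sub_self, zero_mul, norm_zero]
      positivity
    have r1 := re_le_re_sub_of_ne hp h0 h1.le hi hj hij hq2 hq1
    have r2 := re_le_re_sub_of_ne hp h0 h1.le hj hi (Ne.symm hij)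
      (fun h => hq1 (by simpa [Prod.ext_iff, and_comm] using h))
      (fun h => hq2 (by simpa [Prod.ext_iff, and_comm] using h))
    have hAA : ‖A i j - A j i‖ ≤ 4 * v := by
      have : A i j - A j i = (omega p ^ i - omega p ^ j) * (z - w) := by simp only [hA]; ring
      rw [this, norm_mul, hzw']
      nlinarith
    simp only [hE]
    rw [norm_mul]
    have := norm_exp_sub_exp_le (A := A i j) (B := A j i) r1 r2
    calc _ ≤ 2 * (Real.exp (2 * z.re - gap p * ‖z‖) * ‖A i j - A j i‖) := by gcongr
      _ ≤ 2 * (Real.exp (2 * z.re - gap p * ‖z‖) * (4 * v)) := by gcongr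
      _ = _ := by ring
  have hm1 : (0, p - 1) ∈ Finset.range p ×ˢ Finset.range p := by
    simp only [Finset.mem_product, Finset.mem_range]; omega
  have hm2 : (p - 1, 0) ∈ (Finset.range p ×ˢ Finset.range p).erase (0, p - 1) := by
    simp only [Finset.mem_erase, Finset.mem_product, Finset.mem_range, ne_eq, Prod.mk.injEq]
    omega
  rw [← Finset.add_sum_erase _ _ hm1, ← Finset.add_sum_erase _ _ hm2] at hsum
  -- The two extreme pairs contribute equal terms, so they reinforce each other and must be balanced
  -- by all the others.
  have hsymm : E (p - 1, 0) = E (0, p - 1) := by simp only [hE]; ring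
  have hrest : ‖∑ q ∈ ((Finset.range p ×ˢ Finset.range p).erase (0, p - 1)).erase (p - 1, 0), E q‖
      ≤ (p : ℝ) ^ 2 * (8 * v * Real.exp (2 * z.re - gap p * ‖z‖)) := by
    refine (norm_sum_le_of_le _ hbound).trans ?_
    rw [Finset.sum_const, nsmul_eq_mul]
    gcongr
    calc _ ≤ (((Finset.range p ×ˢ Finset.range p).card : ℕ) : ℝ) := by
          exact_mod_cast Finset.card_le_card
            ((Finset.erase_subset _ _).trans (Finset.erase_subset _ _))
      _ = _ := by simp [sq]
  have hmain : 2 * ‖E (0, p - 1)‖ ≤ (p : ℝ) ^ 2 * (8 * v * Real.exp (2 * z.re - gap p * ‖z‖)) := by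
    have : ∑ q ∈ ((Finset.range p ×ˢ Finset.range p).erase (0, p - 1)).erase (p - 1, 0), E q
        = -(2 * E (0, p - 1)) := by
      rw [hsymm] at hsum
      linear_combination hsum
    rw [this, norm_neg, norm_mul] at hrest
    simpa using hrest
  have hω1 : ‖omega p ^ 0 - omega p ^ (p - 1)‖ = 2 * Real.sin (Real.pi / p) := by
    have e : omega p ^ 0 - omega p ^ (p - 1) =
        Complex.exp ((-(Real.pi / p) : ℝ) * Complex.I) *
          (((2 * Real.sin (Real.pi / p) : ℝ) : ℂ) * Complex.I) := by
      have h1 : omega p ^ (p - 1) = (starRingEnd ℂ) (omega p ^ 1) := by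
        rw [conj_omega_pow hp0 (show 1 + (p - 1) = p by omega)]
      rw [h1, omega_pow_eq p 1, pow_zero]
      have hcs := Real.cos_sq_add_sin_sq (Real.pi / p)
      apply Complex.ext
      · rw [Complex.sub_re, Complex.conj_re, Complex.mul_re, Complex.exp_ofReal_mul_I_re,
          Complex.exp_ofReal_mul_I_re, Complex.exp_ofReal_mul_I_im, Nat.cast_one, mul_one,
          Real.cos_two_mul, Real.cos_neg, Real.sin_neg]
        simp only [Complex.one_re, Complex.re_ofReal_mul, Complex.im_ofReal_mul,
          Complex.I_re, Complex.I_im]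
        linear_combination (-2) * hcs
      · rw [Complex.sub_im, Complex.conj_im, Complex.mul_im, Complex.exp_ofReal_mul_I_im,
          Complex.exp_ofReal_mul_I_re, Complex.exp_ofReal_mul_I_im, Nat.cast_one, mul_one,
          Real.sin_two_mul, Real.cos_neg, Real.sin_neg]
        simp only [Complex.one_im, Complex.re_ofReal_mul, Complex.im_ofReal_mul,
          Complex.I_re, Complex.I_im]
        ring
    rw [e, norm_mul, Complex.norm_exp_ofReal_mul_I, norm_mul, Complex.norm_real,
      Real.norm_of_nonneg (by positivity), Complex.norm_I, one_mul, mul_one]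
  have hω3 : omega p ^ (p - 1) * omega p = 1 := by
    rw [← pow_succ, Nat.sub_add_cancel (by omega), omega_pow_self hp0]
  have hA1 : A 0 (p - 1) = ((2 * z.re : ℝ) : ℂ) := by
    have : A 0 (p - 1) = z + (omega p ^ (p - 1) * omega p) * (starRingEnd ℂ) z := by
      simp only [hA, hw, pow_zero]; ring
    rw [this, hω3, one_mul, Complex.add_conj]
  have hA2 : A (p - 1) 0 = ((2 * (z.re - 2 * Real.sin (Real.pi / p) * v) : ℝ) : ℂ) := by
    have h1 : omega p = (starRingEnd ℂ) (omega p ^ (p - 1)) := by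
      rw [conj_omega_pow hp0 (show (p - 1) + 1 = p by omega), pow_one]
    have : A (p - 1) 0 = omega p ^ (p - 1) * z + (starRingEnd ℂ) (omega p ^ (p - 1) * z) := by
      rw [map_mul, ← h1]
      simp only [hA, hw, pow_zero, one_mul]
    rw [this, Complex.add_conj, re_omega_pow_pred_mul hp]
  have hE0 : ‖E (0, p - 1)‖ = 2 * Real.sin (Real.pi / p) *
      (Real.exp (2 * z.re) - Real.exp (2 * (z.re - 2 * Real.sin (Real.pi / p) * v))) := by
    simp only [hE]
    rw [norm_mul, hω1, hA1, hA2, ← Complex.ofReal_exp, ← Complex.ofReal_exp, ← Complex.ofReal_sub,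
      Complex.norm_real, Real.norm_of_nonneg]
    rw [sub_nonneg]
    apply Real.exp_le_exp.2
    nlinarith [mul_pos hs hv0]
  set σ := Real.sin (Real.pi / p) with hσ
  rw [hE0, show 2 * (z.re - 2 * σ * v) = 2 * z.re + -(4 * v * σ) by ring, Real.exp_add,
    show 2 * z.re - gap p * ‖z‖ = 2 * z.re + -(gap p * ‖z‖) by ring, Real.exp_add] at hmain
  have hmain' : 4 * σ * (1 - Real.exp (-(4 * v * σ))) ≤
      (p : ℝ) ^ 2 * (8 * v * Real.exp (-(gap p * ‖z‖))) := by
    refine le_of_mul_le_mul_left ?_ (Real.exp_pos (2 * z.re))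
    linarith
  -- 1 - exp(-x) ≥ x / (1 + x) at x = 4vσ. This exposes a factor v in the main term, which then
  -- cancels the one in the error and leaves a bound uniform up to the line.
  have hexp : 4 * v * σ ≤ (1 + 4 * v * σ) * (1 - Real.exp (-(4 * v * σ))) := by
    have h1 : 1 + 4 * v * σ ≤ Real.exp (4 * v * σ) := by
      linarith [Real.add_one_le_exp (4 * v * σ)]
    have h2 : (1 + 4 * v * σ) * Real.exp (-(4 * v * σ)) ≤ 1 := by
      calc _ ≤ Real.exp (4 * v * σ) * Real.exp (-(4 * v * σ)) := by gcongr
        _ = 1 := by rw [← Real.exp_add]; simp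
    linarith
  have hvz : v * σ ≤ ‖z‖ := by
    have h1 : z.re ≤ ‖z‖ := Complex.re_le_norm z
    have hcs := Real.cos_sq_add_sin_sq (Real.pi / p)
    have hc := cos_angle_ge hp
    have hσ1 : σ ≤ 1 := Real.sin_le_one _
    have hx : 0 ≤ z.re := by
      by_contra! hneg
      nlinarith
    have : v ≤ z.re := by rw [hv]; nlinarith
    nlinarith
  have hfin : σ ^ 2 ≤ (p : ℝ) ^ 2 * (1 + 4 * ‖z‖) * Real.exp (-(gap p * ‖z‖)) := by
    have hpos : 0 < 1 + 4 * v * σ := by positivity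
    have h2 : 16 * v * σ ^ 2 ≤ (1 + 4 * v * σ) *
        ((p : ℝ) ^ 2 * (8 * v * Real.exp (-(gap p * ‖z‖)))) := by
      calc 16 * v * σ ^ 2 = 4 * σ * (4 * v * σ) := by ring
        _ ≤ 4 * σ * ((1 + 4 * v * σ) * (1 - Real.exp (-(4 * v * σ)))) := by gcongr
        _ = (1 + 4 * v * σ) * (4 * σ * (1 - Real.exp (-(4 * v * σ)))) := by ring
        _ ≤ _ := by gcongr
    have h3 : 2 * σ ^ 2 ≤ (1 + 4 * v * σ) * ((p : ℝ) ^ 2 * Real.exp (-(gap p * ‖z‖))) := by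
      refine le_of_mul_le_mul_left ?_ (show 0 < 8 * v by positivity)
      linarith
    have h4 : (1 + 4 * v * σ) * ((p : ℝ) ^ 2 * Real.exp (-(gap p * ‖z‖))) ≤
        (1 + 4 * ‖z‖) * ((p : ℝ) ^ 2 * Real.exp (-(gap p * ‖z‖))) := by
      gcongr ?_ * _
      linarith
    nlinarith [sq_nonneg σ]
  exact absurd (hr₀ ‖z‖ hz) (not_lt.2 hfin)

/-! ### Comparison with exp, and boundary values on half-strips. -/

/-- In a strip of bounded height each term with k ≠ 0 has modulus at most exp(x cos(2π/p) + Y), and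
cos(2π/p) < 1. -/
lemma exists_forall_norm_sub_exp_le {p : ℕ} (hp : 3 ≤ p) (Y : ℝ) {ε : ℝ} (hε : 0 < ε) :
    ∃ X : ℝ, 0 ≤ X ∧ ∀ z : ℂ, |z.im| ≤ Y → X ≤ z.re →
      ‖expSum p z - Complex.exp z‖ ≤ ε * Real.exp z.re ∧
      ‖expSumDeriv p z - Complex.exp z‖ ≤ ε * Real.exp z.re := by
  set b := Real.pi / p with hb
  have hbp : 0 < b := angle_pos hp
  have hble : b ≤ Real.pi / 3 := angle_le hp
  set κ := 1 - Real.cos (2 * b) with hκ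
  have hκ0 : 0 < κ := by
    have := Real.cos_lt_cos_of_nonneg_of_le_pi (x := 0) (y := 2 * b) le_rfl
      (by linarith [Real.pi_pos]) (by linarith)
    rw [Real.cos_zero] at this
    linarith
  have htend : Tendsto (fun x : ℝ => (p : ℝ) * Real.exp Y * Real.exp (-(κ * x))) atTop (𝓝 0) := by
    have := (Real.tendsto_exp_neg_atTop_nhds_zero.comp
      (tendsto_id.const_mul_atTop hκ0)).const_mul ((p : ℝ) * Real.exp Y)
    simpa using this
  obtain ⟨X, hX⟩ := eventually_atTop.1 (htend.eventually_lt_const hε)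
  refine ⟨max X 0, le_max_right _ _, fun z hz hx => ?_⟩
  have hx0 : 0 ≤ z.re := (le_max_right _ _).trans hx
  have hXx : (p : ℝ) * Real.exp Y * Real.exp (-(κ * z.re)) < ε :=
    hX _ ((le_max_left _ _).trans hx)
  have hpb : (p : ℝ) * b = Real.pi := by
    have : (p : ℝ) ≠ 0 := by exact_mod_cast (by omega : p ≠ 0)
    rw [hb]; field_simp
  have hterm : ∀ k ∈ Finset.range (p - 1),
      ‖Complex.exp (omega p ^ (k + 1) * z)‖ ≤ Real.exp (z.re * Real.cos (2 * b) + Y) := by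
    intro k hk
    rw [Complex.norm_exp]
    apply Real.exp_le_exp.2
    rw [re_omega_pow_mul, ← hb]
    have hk' : k + 2 ≤ p := by have := Finset.mem_range.1 hk; omega
    have hk2 : (k : ℝ) + 2 ≤ p := by exact_mod_cast hk'
    have hk0 : (0 : ℝ) ≤ k := Nat.cast_nonneg k
    push_cast
    have c1 : Real.cos (2 * ((k : ℝ) + 1) * b) ≤ Real.cos (2 * b) :=
      cos_le_cos_of_mem (by linarith) (by nlinarith) (by nlinarith)
    have c2 : |Real.sin (2 * ((k : ℝ) + 1) * b) * z.im| ≤ Y := by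
      rw [abs_mul]
      have := Real.abs_sin_le_one (2 * ((k : ℝ) + 1) * b)
      nlinarith [abs_nonneg z.im]
    have c3 := neg_le_of_abs_le c2
    have c4 := mul_le_mul_of_nonneg_right c1 hx0
    linarith
  have hcard : ((p - 1 : ℕ) : ℝ) * Real.exp (z.re * Real.cos (2 * b) + Y) ≤
      ε * Real.exp z.re := by
    have : z.re * Real.cos (2 * b) + Y = Y + -(κ * z.re) + z.re := by rw [hκ]; ring
    rw [this, Real.exp_add, Real.exp_add, ← mul_assoc, ← mul_assoc]
    gcongr
    refine le_trans ?_ hXx.le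
    gcongr
    omega
  have hps : p = (p - 1) + 1 := by omega
  constructor
  · have : expSum p z - Complex.exp z =
        ∑ k ∈ Finset.range (p - 1), Complex.exp (omega p ^ (k + 1) * z) := by
      conv_lhs => rw [expSum]; arg 1; arg 1; rw [hps]
      rw [Finset.sum_range_succ']
      simp
    rw [this]
    refine (norm_sum_le_of_le _ hterm).trans ?_
    rw [Finset.sum_const, nsmul_eq_mul, Finset.card_range]
    exact hcard
  · have : expSumDeriv p z - Complex.exp z =
        ∑ k ∈ Finset.range (p - 1), omega p ^ (k + 1) * Complex.exp (omega p ^ (k + 1) * z) := by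
      conv_lhs => rw [expSumDeriv]; arg 1; arg 1; rw [hps]
      rw [Finset.sum_range_succ']
      simp
    rw [this]
    refine (norm_sum_le_of_le (n := fun _ => Real.exp (z.re * Real.cos (2 * b) + Y)) _
      (fun k hk => ?_)).trans ?_
    · rw [norm_mul, norm_omega_pow, one_mul]
      exact hterm k hk
    · rw [Finset.sum_const, nsmul_eq_mul, Finset.card_range]
      exact hcard

/-- The line arg = π/p is fixed pointwise by z ↦ ω·conj z, under which f becomes its conjugate. -/
lemma im_expSum_eq_zero {p : ℕ} (hp : 3 ≤ p) {z : ℂ}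
    (h : z.im * Real.cos (Real.pi / p) = z.re * Real.sin (Real.pi / p)) :
    (expSum p z).im = 0 := by
  have hp0 : p ≠ 0 := by omega
  have hcs := Real.cos_sq_add_sin_sq (Real.pi / p)
  have hz : omega p * (starRingEnd ℂ) z = z := by
    rw [← pow_one (omega p)]
    apply Complex.ext
    · rw [re_omega_pow_mul, Nat.cast_one, mul_one, Real.cos_two_mul, Real.sin_two_mul,
        Complex.conj_re, Complex.conj_im]
      linear_combination 2 * Real.sin (Real.pi / p) * h + 2 * z.re * hcs
    · rw [im_omega_pow_mul, Nat.cast_one, mul_one, Real.cos_two_mul, Real.sin_two_mul,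
        Complex.conj_re, Complex.conj_im]
      linear_combination -2 * Real.cos (Real.pi / p) * h
  have h1 : (starRingEnd ℂ) (expSum p z) = expSum p z := by
    rw [← expSum_conj hp0, ← expSum_omega_mul hp0, hz]
  exact Complex.conj_eq_iff_im.1 h1

lemma im_omega_pow_pred_mul {p : ℕ} (hp : 3 ≤ p) (z : ℂ) :
    (omega p ^ (p - 1) * z).im = -(z.im + 2 * Real.cos (Real.pi / p) *
      (z.re * Real.sin (Real.pi / p) - z.im * Real.cos (Real.pi / p))) := by
  have hpb : (p : ℝ) * (Real.pi / p) = Real.pi := by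
    have : (p : ℝ) ≠ 0 := by exact_mod_cast (by omega : p ≠ 0)
    field_simp
  have h : 2 * ((p - 1 : ℕ) : ℝ) * (Real.pi / p) = 2 * Real.pi - 2 * (Real.pi / p) := by
    rw [Nat.cast_sub (by omega)]
    push_cast
    linear_combination 2 * hpb
  rw [im_omega_pow_mul, h, Real.cos_two_pi_sub, Real.sin_two_pi_sub, Real.cos_two_mul,
    Real.sin_two_mul]
  ring

/-- Far from the origin, `expSum p` maps the parts of the horizontal lines `cos y = -1` that lie
in the sector `0 ≤ arg z ≤ π / p` into the left half-plane. -/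
lemma exists_forall_re_expSum_neg {p : ℕ} (hp : 3 ≤ p) :
    ∃ r₀ : ℝ, ∀ z : ℂ, r₀ ≤ ‖z‖ → 0 ≤ z.im →
      z.im * Real.cos (Real.pi / p) ≤ z.re * Real.sin (Real.pi / p) → Real.cos z.im = -1 →
      (expSum p z).re < 0 := by
  have hs := sin_angle_pos hp
  have hc := cos_angle_ge hp
  set σ := Real.sin (Real.pi / p) with hσ
  set γ := Real.cos (Real.pi / p) with hγ
  set η := 1 - Real.exp (-(σ * (Real.pi / 2))) with hη
  have hη0 : 0 < η := by
    have : Real.exp (-(σ * (Real.pi / 2))) < 1 := by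
      rw [Real.exp_lt_one_iff]
      have := mul_pos hs (half_pos Real.pi_pos)
      linarith
    linarith
  have hη1 : η < 1 := by linarith [Real.exp_pos (-(σ * (Real.pi / 2)))]
  obtain ⟨r₀, hr₀⟩ := exists_forall_exp_lt hp (C := (p : ℝ)) hη0
  refine ⟨r₀, fun z hz h0 h1 hcos => ?_⟩
  have hsin : Real.sin z.im = 0 := by
    have := Real.sin_sq_add_cos_sq z.im
    rw [hcos] at this
    nlinarith
  set v := z.re * σ - z.im * γ with hv
  have hv0 : 0 ≤ v := by rw [hv]; linarith
  have hrest : ‖∑ k ∈ Finset.range (p - 2), Complex.exp (omega p ^ (k + 1) * z)‖ ≤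
      p * (Real.exp z.re * Real.exp (-(gap p * ‖z‖))) := by
    refine (norm_sum_le_of_le (n := fun _ => Real.exp z.re * Real.exp (-(gap p * ‖z‖))) _
      fun k hk => ?_).trans ?_
    · have := Finset.mem_range.1 hk
      rw [Complex.norm_exp, ← Real.exp_add]
      apply Real.exp_le_exp.2
      have := re_omega_pow_mul_le hp h0 h1 (k := k + 1) (by omega) (by omega)
      linarith
    · rw [Finset.sum_const, nsmul_eq_mul, Finset.card_range]
      gcongr
      omega
  have hsplit : expSum p z = Complex.exp z + Complex.exp (omega p ^ (p - 1) * z) +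
      ∑ k ∈ Finset.range (p - 2), Complex.exp (omega p ^ (k + 1) * z) := by
    have hps : p = (p - 2) + 1 + 1 := by omega
    conv_lhs => rw [expSum]; arg 1; rw [hps]
    rw [Finset.sum_range_succ, Finset.sum_range_succ', show p - 2 + 1 = p - 1 by omega]
    simp
    ring
  have e1 : (Complex.exp z).re = -Real.exp z.re := by rw [Complex.exp_re, hcos]; ring
  have e2 : (Complex.exp (omega p ^ (p - 1) * z)).re =
      -(Real.exp z.re * Real.exp (-(2 * σ * v)) * Real.cos (2 * γ * v)) := by
    rw [Complex.exp_re, re_omega_pow_pred_mul hp, im_omega_pow_pred_mul hp, Real.cos_neg,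
      Real.cos_add, hcos, hsin, sub_eq_add_neg, Real.exp_add]
    ring
  have e3 := (Complex.re_le_norm _).trans hrest
  -- The bracket is minus the sum of the two dominant real parts, divided by exp(Re z). Either the
  -- cosine is nonnegative, or v ≥ π/4 and the second exponential is smaller than the first by the
  -- factor exp(-σπ/2) that defines η.
  have key : η ≤ 1 + Real.exp (-(2 * σ * v)) * Real.cos (2 * γ * v) := by
    by_cases hcase : 2 * γ * v ≤ Real.pi / 2
    · have : 0 ≤ Real.cos (2 * γ * v) :=
        Real.cos_nonneg_of_neg_pi_div_two_le_of_le
          (by have : 0 ≤ 2 * γ * v := by positivity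
              linarith [Real.pi_pos]) hcase
      nlinarith [Real.exp_pos (-(2 * σ * v))]
    · have hγ1 : γ ≤ 1 := Real.cos_le_one _
      have hv1 : Real.pi / 4 ≤ v := by nlinarith
      have h2 : Real.exp (-(2 * σ * v)) ≤ Real.exp (-(σ * (Real.pi / 2))) := by
        apply Real.exp_le_exp.2
        nlinarith
      nlinarith [Real.neg_one_le_cos (2 * γ * v), Real.exp_pos (-(2 * σ * v))]
  have hlt := hr₀ ‖z‖ hz
  have hex := Real.exp_pos z.re
  have hlt' : (p : ℝ) * Real.exp (-(gap p * ‖z‖)) < η := by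
    refine lt_of_le_of_lt ?_ hlt
    gcongr ?_ * _
    have : (0 : ℝ) ≤ p := Nat.cast_nonneg p
    nlinarith [norm_nonneg z]
  rw [hsplit, Complex.add_re, Complex.add_re, e1, e2]
  have k1 := mul_le_mul_of_nonneg_left key hex.le
  have k2 := mul_lt_mul_of_pos_left hlt' hex
  nlinarith

/-- The open half-strip cut out of `R(m)` by the line `y = tan (π / p) x`. -/
def halfStrip (p m : ℕ) : Set ℂ :=
  {z | (2 * (m : ℝ) - 1) * Real.pi < z.im ∧ z.im < (2 * (m : ℝ) + 1) * Real.pi ∧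
    z.im * Real.cos (Real.pi / p) < z.re * Real.sin (Real.pi / p)}

/-- The closed version of `halfStrip`. -/
def closedHalfStrip (p m : ℕ) : Set ℂ :=
  {z | (2 * (m : ℝ) - 1) * Real.pi ≤ z.im ∧ z.im ≤ (2 * (m : ℝ) + 1) * Real.pi ∧
    z.im * Real.cos (Real.pi / p) ≤ z.re * Real.sin (Real.pi / p)}

lemma isOpen_halfStrip (p m : ℕ) : IsOpen (halfStrip p m) :=
  (isOpen_lt continuous_const Complex.continuous_im).inter
    ((isOpen_lt Complex.continuous_im continuous_const).inter
      (isOpen_lt (Complex.continuous_im.mul_const _) (Complex.continuous_re.mul_const _)))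

lemma isClosed_closedHalfStrip (p m : ℕ) : IsClosed (closedHalfStrip p m) :=
  (isClosed_le continuous_const Complex.continuous_im).inter
    ((isClosed_le Complex.continuous_im continuous_const).inter
      (isClosed_le (Complex.continuous_im.mul_const _) (Complex.continuous_re.mul_const _)))

lemma halfStrip_subset_closedHalfStrip (p m : ℕ) : halfStrip p m ⊆ closedHalfStrip p m :=
  fun _ h => ⟨h.1.le, h.2.1.le, h.2.2.le⟩

/-- In the half-strip ‖z‖ ≥ Im z ≥ m, so a large m passes both thresholds. Horizontal edges go to
the left half-plane and the oblique edge to the real axis, so values off both come from the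
interior. -/
lemma exists_forall_halfStrip {p : ℕ} (hp : 3 ≤ p) :
    ∃ m₀ : ℕ, 1 ≤ m₀ ∧ ∀ m, m₀ ≤ m →
      (∀ z ∈ halfStrip p m, expSumDeriv p z ≠ 0) ∧
      (∀ z ∈ closedHalfStrip p m, 0 < (expSum p z).re → (expSum p z).im ≠ 0 →
        z ∈ halfStrip p m) := by
  obtain ⟨r₁, h₁⟩ := exists_forall_expSumDeriv_ne_zero hp
  obtain ⟨r₂, h₂⟩ := exists_forall_re_expSum_neg hp
  refine ⟨max 1 ⌈max r₁ r₂⌉₊, le_max_left _ _, fun m hm => ?_⟩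
  have hm1 : (1 : ℝ) ≤ m := by exact_mod_cast (le_max_left _ _).trans hm
  have hmr : max r₁ r₂ ≤ m :=
    (Nat.le_ceil _).trans (by exact_mod_cast (le_max_right _ _).trans hm)
  have him : ∀ z ∈ closedHalfStrip p m, (m : ℝ) ≤ z.im := by
    intro z hz
    have := hz.1
    nlinarith [Real.pi_gt_three]
  have hn : ∀ z ∈ closedHalfStrip p m, max r₁ r₂ ≤ ‖z‖ := fun z hz =>
    hmr.trans ((him z hz).trans (Complex.im_le_norm z))
  constructor
  · intro z hz
    have hz' := halfStrip_subset_closedHalfStrip p m hz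
    exact h₁ z ((le_max_left _ _).trans (hn z hz')) (by linarith [him z hz']) hz.2.2
  · intro z hz hre himne
    have hcos : Real.cos z.im ≠ -1 := fun hcos => by
      have := h₂ z ((le_max_right _ _).trans (hn z hz)) (by linarith [him z hz]) hz.2.2 hcos
      linarith
    refine ⟨lt_of_le_of_ne hz.1 fun h => hcos ?_, lt_of_le_of_ne hz.2.1 fun h => hcos ?_,
      lt_of_le_of_ne hz.2.2 fun h => himne (im_expSum_eq_zero hp h)⟩
    · rw [← h, show (2 * (m : ℝ) - 1) * Real.pi = m * (2 * Real.pi) - Real.pi by ring]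
      exact Real.cos_nat_mul_two_pi_sub_pi m
    · rw [h, show (2 * (m : ℝ) + 1) * Real.pi = m * (2 * Real.pi) + Real.pi by ring]
      exact Real.cos_nat_mul_two_pi_add_pi m

/-! ### Covering argument and inverse branches. -/

section Branches

variable {f f' : ℂ → ℂ} {S T Q : Set ℂ}

lemma map_nhds_eq_of_hasDerivAt (hf : ∀ z, HasDerivAt f (f' z) z) {z : ℂ} (hz : f' z ≠ 0) :
    Filter.map f (𝓝 z) = 𝓝 (f z) := by
  have hd : Differentiable ℂ f := fun z => (hf z).differentiableAt
  have hs : HasStrictDerivAt f (f' z) z := by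
    rw [← (hf z).deriv]
    exact (hd.analyticAt z).hasStrictDerivAt
  exact hs.map_nhds_eq hz

lemma exists_tendsto_subseq_of_tendsto (hf : ∀ z, HasDerivAt f (f' z) z) (hT : IsClosed T)
    (hbdd : ∀ R : ℝ, Bornology.IsBounded {z | z ∈ T ∧ ‖f z‖ ≤ R}) {u : ℕ → ℂ} {w : ℂ}
    (hu : ∀ n, u n ∈ T) (hw : Tendsto (fun n => f (u n)) atTop (𝓝 w)) :
    ∃ z ∈ T, f z = w ∧ ∃ φ : ℕ → ℕ, StrictMono φ ∧ Tendsto (u ∘ φ) atTop (𝓝 z) := by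
  obtain ⟨R, hR⟩ := hw.norm.bddAbove_range
  have hR' : ∀ n, u n ∈ {z | z ∈ T ∧ ‖f z‖ ≤ R} := fun n => ⟨hu n, hR ⟨n, rfl⟩⟩
  obtain ⟨z, -, φ, hφ, hz⟩ := tendsto_subseq_of_bounded (hbdd R) hR'
  refine ⟨z, hT.mem_of_tendsto hz (Eventually.of_forall fun n => hu _), ?_, φ, hφ, hz⟩
  exact tendsto_nhds_unique (((hf z).continuousAt.tendsto).comp hz) (hw.comp hφ.tendsto_atTop)

/-- A holomorphic map that is proper over a connected set, without critical points, and takes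
one value of this set exactly once, takes all of them exactly once. -/
lemma existsUnique_of_proper (hf : ∀ z, HasDerivAt f (f' z) z) (hS : IsOpen S) (hT : IsClosed T)
    (hST : S ⊆ T) (hQ : IsPreconnected Q) (hmem : ∀ z ∈ T, f z ∈ Q → z ∈ S)
    (hne : ∀ z ∈ S, f' z ≠ 0) (hbdd : ∀ R : ℝ, Bornology.IsBounded {z | z ∈ T ∧ ‖f z‖ ≤ R})
    {w₀ : ℂ} (hw₀ : w₀ ∈ Q) (h₀ : ∃! z, z ∈ S ∧ f z = w₀) {w : ℂ} (hw : w ∈ Q) :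
    ∃! z, z ∈ S ∧ f z = w := by
  obtain ⟨z₀, ⟨hz₀S, hz₀⟩, huniq⟩ := h₀
  -- The image is open since f' ≠ 0 and relatively closed in Q by properness; Q is connected.
  have hsurj : Q ⊆ f '' S := by
    apply hQ.subset_of_closure_inter_subset
    · rw [isOpen_iff_mem_nhds]
      rintro _ ⟨z, hz, rfl⟩
      rw [← map_nhds_eq_of_hasDerivAt hf (hne z hz)]
      exact image_mem_map (hS.mem_nhds hz)
    · exact ⟨w₀, hw₀, z₀, hz₀S, hz₀⟩
    · rintro x ⟨hx, hxQ⟩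
      obtain ⟨y, hy, hyx⟩ := mem_closure_iff_seq_limit.1 hx
      choose u hu huy using hy
      obtain ⟨z, hzT, hzx, -⟩ := exists_tendsto_subseq_of_tendsto hf hT hbdd
        (fun n => hST (hu n)) (hyx.congr fun n => (huy n).symm)
      exact ⟨z, hmem z hzT (hzx ▸ hxQ), hzx⟩
  obtain ⟨z, hzS, hzw⟩ := hsurj hw
  refine ⟨z, ⟨hzS, hzw⟩, ?_⟩
  rintro z' ⟨hz'S, hz'w⟩
  by_contra hzz'
  -- The same open-and-closed argument for the values taken at least twice: if there is one in Q,
  -- then all of Q consists of them, including w₀.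
  have hsub : Q ⊆ {x | ∃ a ∈ S, ∃ b ∈ S, a ≠ b ∧ f a = x ∧ f b = x} := by
    apply hQ.subset_of_closure_inter_subset
    · rw [isOpen_iff_mem_nhds]
      rintro x ⟨a, ha, b, hb, hab, hax, hbx⟩
      obtain ⟨U, V, hU, hV, haU, hbV, hUV⟩ := t2_separation hab
      have h1 : f '' (S ∩ U) ∈ 𝓝 x := by
        rw [← hax, ← map_nhds_eq_of_hasDerivAt hf (hne a ha)]
        exact image_mem_map ((hS.inter hU).mem_nhds ⟨ha, haU⟩)
      have h2 : f '' (S ∩ V) ∈ 𝓝 x := by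
        rw [← hbx, ← map_nhds_eq_of_hasDerivAt hf (hne b hb)]
        exact image_mem_map ((hS.inter hV).mem_nhds ⟨hb, hbV⟩)
      filter_upwards [h1, h2]
      rintro y ⟨c, ⟨hcS, hcU⟩, hcy⟩ ⟨d, ⟨hdS, hdV⟩, hdy⟩
      exact ⟨c, hcS, d, hdS, hUV.ne_of_mem hcU hdV, hcy, hdy⟩
    · exact ⟨w, hw, z, hzS, z', hz'S, Ne.symm hzz', hzw, hz'w⟩
    · rintro x ⟨hx, hxQ⟩
      obtain ⟨y, hy, hyx⟩ := mem_closure_iff_seq_limit.1 hx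
      choose u hu v hv huv huy hvy using hy
      obtain ⟨a, haT, hax, φ, hφ, hua⟩ := exists_tendsto_subseq_of_tendsto hf hT hbdd
        (fun n => hST (hu n)) (hyx.congr fun n => (huy n).symm)
      obtain ⟨b, hbT, hbx, ψ, hψ, hvb⟩ := exists_tendsto_subseq_of_tendsto (u := v ∘ φ) hf hT hbdd
        (fun n => hST (hv _)) ((hyx.comp hφ.tendsto_atTop).congr fun n => (hvy _).symm)
      have haS := hmem a haT (hax ▸ hxQ)
      refine ⟨a, haS, b, hmem b hbT (hbx ▸ hxQ), ?_, hax, hbx⟩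
      -- Two sequences of distinct preimages cannot merge in the limit, because f is injective near
      -- a non-critical point.
      rintro rfl
      have hd : Differentiable ℂ f := fun z => (hf z).differentiableAt
      have hs : HasStrictDerivAt f (f' a) a := by
        rw [← (hf a).deriv]
        exact (hd.analyticAt a).hasStrictDerivAt
      have hinj := hs.eventually_left_inverse (hne a haS)
      have e1 := (hua.comp hψ.tendsto_atTop).eventually hinj
      have e2 := hvb.eventually hinj
      obtain ⟨n, hn1, hn2⟩ := (e1.and e2).exists
      simp only [Function.comp_apply] at hn1 hn2
      rw [huy] at hn1
      rw [hvy] at hn2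
      exact huv _ (hn1.symm.trans hn2)
  obtain ⟨a, ha, b, hb, hab, hax, hbx⟩ := hsub hw₀
  exact hab ((huniq a ⟨ha, hax⟩).trans (huniq b ⟨hb, hbx⟩).symm)

/-- The inverse branch of a holomorphic map over a set on which its fibres are singletons. -/
lemma exists_inverse_branch (hf : ∀ z, HasDerivAt f (f' z) z) (hS : IsOpen S)
    (hne : ∀ z ∈ S, f' z ≠ 0) (hQ : IsOpen Q) (huniq : ∀ w ∈ Q, ∃! z, z ∈ S ∧ f z = w) :
    ∃ g : ℂ → ℂ, (∀ w ∈ Q, g w ∈ S ∧ f (g w) = w ∧ HasDerivAt g (f' (g w))⁻¹ w) ∧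
      ∀ z ∈ S, f z ∈ Q → g (f z) = z := by
  classical
  choose! g hg hgu using huniq
  refine ⟨g, fun w hw => ⟨(hg w hw).1, (hg w hw).2, ?_⟩, fun z hz hfz => (hgu _ hfz z ⟨hz, rfl⟩).symm⟩
  obtain ⟨hgS, hgw⟩ := hg w hw
  have hd : Differentiable ℂ f := fun z => (hf z).differentiableAt
  have hs : HasStrictDerivAt f (f' (g w)) (g w) := by
    rw [← (hf (g w)).deriv]
    exact (hd.analyticAt _).hasStrictDerivAt
  have hne' := hne _ hgS
  have hloc := (hs.to_localInverse hne').hasDerivAt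
  rw [hgw] at hloc
  -- Uniqueness of the preimage in S forces the global choice to agree with the local inverse, which
  -- is differentiable.
  refine hloc.congr_of_eventuallyEq ?_
  have h1 := hs.eventually_right_inverse hne'
  have h2 : ∀ᶠ x in 𝓝 (f (g w)), hs.localInverse f (f' (g w)) (g w) hne' x ∈ S := by
    have hc := (hs.to_localInverse hne').hasDerivAt.continuousAt
    apply hc.eventually_mem
    have h3 : hs.localInverse f (f' (g w)) (g w) hne' (f (g w)) = g w :=
      (hs.eventually_left_inverse hne').self_of_nhds
    rw [h3]
    exact hS.mem_nhds hgS
  rw [hgw] at h1 h2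
  filter_upwards [h1, h2, hQ.mem_nhds hw] with x hx1 hx2 hxQ
  exact (hgu x hxQ _ ⟨hx2, hx1⟩).symm

end Branches

/-! ### Derivative bound for maps into a strip, and an injectivity criterion. -/

/-- A holomorphic map of a disc of radius `d` into a horizontal strip of width `2 * π` has
derivative at most `8 * π / d` at the centre. -/
lemma norm_deriv_le_of_mapsTo_strip {g : ℂ → ℂ} {w g' : ℂ} {d a : ℝ} (hd : 0 < d)
    (hg : DifferentiableOn ℂ g (Metric.ball w d)) (hg' : HasDerivAt g g' w)
    (hS : ∀ x ∈ Metric.ball w d, a < (g x).im ∧ (g x).im < a + 2 * Real.pi) :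
    ‖g'‖ ≤ 8 * Real.pi / d := by
  have hpi := Real.pi_pos
  -- The factor i turns the bounded imaginary part into a real part at most 2π, as
  -- Borel–Carathéodory requires; restricting to the half disc then gives 8π/d.
  set G : ℂ → ℂ := fun ξ => Complex.I * (g (w + ξ) - g w) with hG
  have hmap : Set.MapsTo (fun ξ : ℂ => w + ξ) (Metric.ball 0 d) (Metric.ball w d) := by
    intro ξ hξ
    simpa using hξ
  have hGd : DifferentiableOn ℂ G (Metric.ball 0 d) :=
    ((hg.comp (by fun_prop) hmap).sub_const _).const_mul _
  have hGm : Set.MapsTo G (Metric.ball 0 d) {z | z.re ≤ 2 * Real.pi} := by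
    intro ξ hξ
    have h1 := hS _ (hmap hξ)
    have h2 := hS w (Metric.mem_ball_self hd)
    simp only [hG, Set.mem_ofPred_eq, Complex.mul_re, Complex.I_re, Complex.I_im, Complex.sub_im]
    linarith
  refine hg'.le_of_lip' (by positivity) ?_
  filter_upwards [Metric.ball_mem_nhds w (half_pos hd)] with x hx
  have hx' : ‖x - w‖ < d / 2 := by simpa [dist_eq_norm] using hx
  have hb := Complex.borelCaratheodory_zero (z := x - w) (by positivity) hGd hGm hd
    (by simpa using hx'.trans (half_lt_self hd)) (by simp [hG])
  have hn : ‖G (x - w)‖ = ‖g x - g w‖ := by simp [hG]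
  rw [hn] at hb
  refine hb.trans ?_
  rw [div_mul_eq_mul_div, div_le_div_iff₀ (by linarith) hd]
  nlinarith [mul_nonneg (norm_nonneg (x - w)) (sub_nonneg.2 hx'.le)]

/-- A holomorphic function whose derivative has positive real part, after a rotation, on the
segment between two distinct points separates these points. -/
lemma ne_of_re_mul_deriv_pos {f f' : ℂ → ℂ} (hf : ∀ z, HasDerivAt f (f' z) z) {c a b : ℂ}
    (hab : a ≠ b) (h : ∀ t ∈ Set.Ioo (0 : ℝ) 1, 0 < (c * f' (a + t * (b - a))).re) :
    f a ≠ f b := by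
  intro hfab
  have hba : b - a ≠ 0 := sub_ne_zero.2 hab.symm
  -- Dividing by b - a makes the derivative along the segment exactly Re(c f'). Equal end values
  -- would force a zero of it by the mean value theorem.
  have hder : ∀ t : ℝ, HasDerivAt (fun t : ℝ => (c * (b - a)⁻¹ * f (a + t * (b - a))).re)
      (c * f' (a + t * (b - a))).re t := by
    intro t
    have h1 : HasDerivAt (fun t : ℝ => a + (t : ℂ) * (b - a)) (b - a) t := by
      have := (Complex.ofRealCLM.hasDerivAt (x := t)).mul_const (b - a)
      simpa using this.const_add a
    have h2 := ((hf (a + t * (b - a))).comp t h1).const_mul (c * (b - a)⁻¹)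
    have h3 : HasDerivAt (fun t : ℝ => (c * (b - a)⁻¹ * f (a + t * (b - a))).re)
        (c * (b - a)⁻¹ * (f' (a + t * (b - a)) * (b - a))).re t :=
      Complex.reCLM.hasFDerivAt.comp_hasDerivAt t h2
    have h4 : c * (b - a)⁻¹ * (f' (a + t * (b - a)) * (b - a)) = c * f' (a + t * (b - a)) := by
      field_simp
    rwa [h4] at h3
  obtain ⟨t, ht, htd⟩ := exists_hasDerivAt_eq_slope _ _ (zero_lt_one' ℝ)
    (fun x _ => (hder x).continuousAt.continuousWithinAt) (fun x _ => hder x)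
  have := h t ht
  rw [htd] at this
  simp [hfab] at this

/-! ### Inverse branches of f over the quadrants. -/

lemma norm_expSum_le (p : ℕ) (z : ℂ) : ‖expSum p z‖ ≤ p * Real.exp ‖z‖ := by
  refine (norm_sum_le_of_le (n := fun _ => Real.exp ‖z‖) _ fun k _ => ?_).trans_eq ?_
  · rw [Complex.norm_exp]
    apply Real.exp_le_exp.2
    refine (Complex.re_le_norm _).trans_eq ?_
    rw [norm_mul, norm_omega_pow, one_mul]
  · rw [Finset.sum_const, nsmul_eq_mul, Finset.card_range]

lemma halfStrip_abs_im_le {p m : ℕ} {z : ℂ} (hz : z ∈ closedHalfStrip p m) (hm : 1 ≤ m) :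
    |z.im| ≤ (2 * m + 1) * Real.pi := by
  have hm1 : (1 : ℝ) ≤ m := by exact_mod_cast hm
  rw [abs_of_nonneg]
  · exact hz.2.1
  · have := hz.1
    nlinarith [Real.pi_pos]

lemma halfStrip_re_pos {p m : ℕ} (hp : 3 ≤ p) {z : ℂ} (hz : z ∈ closedHalfStrip p m) (hm : 1 ≤ m) :
    0 < z.re := by
  have hm1 : (1 : ℝ) ≤ m := by exact_mod_cast hm
  have h1 := hz.1
  have h2 := hz.2.2
  have hs := sin_angle_pos hp
  have hc := cos_angle_ge hp
  have : 0 < z.im := by nlinarith [Real.pi_pos]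
  by_contra! h
  nlinarith

lemma norm_expSum_ge {p : ℕ} {z : ℂ}
    (h : ‖expSum p z - Complex.exp z‖ ≤ 1 / 16 * Real.exp z.re) :
    1 / 2 * Real.exp z.re ≤ ‖expSum p z‖ := by
  have h1 := norm_sub_norm_le (Complex.exp z) (Complex.exp z - expSum p z)
  rw [Complex.norm_exp, norm_sub_rev (Complex.exp z)] at h1
  have h2 : Complex.exp z - (Complex.exp z - expSum p z) = expSum p z := by ring
  rw [h2] at h1
  linarith [Real.exp_pos z.re]

/-- This is the properness of f on the half-strip: far to the right |f| ≥ exp(Re z)/2. -/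
lemma isBounded_closedHalfStrip_inter {p m : ℕ} (hp : 3 ≤ p) (hm : 1 ≤ m) (R : ℝ) :
    Bornology.IsBounded {z | z ∈ closedHalfStrip p m ∧ ‖expSum p z‖ ≤ R} := by
  obtain ⟨X, hX0, hX⟩ := exists_forall_norm_sub_exp_le hp ((2 * m + 1) * Real.pi)
    (ε := 1 / 16) (by norm_num)
  refine (isBounded_iff_forall_norm_le).2 ⟨max X (2 * R) + (2 * m + 1) * Real.pi, ?_⟩
  rintro z ⟨hz, hzR⟩
  have him := halfStrip_abs_im_le hz hm
  have hre : |z.re| ≤ max X (2 * R) := by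
    rw [abs_of_pos (halfStrip_re_pos hp hz hm)]
    by_contra! h
    have h1 := norm_expSum_ge (hX z him ((le_max_left _ _).trans h.le)).1
    have h2 := Real.add_one_le_exp z.re
    have h3 := (le_max_right _ _).trans_lt h
    linarith
  exact (Complex.norm_le_abs_re_add_abs_im z).trans (add_le_add hre him)

lemma abs_lt_one_of_cos {θ : ℝ} (h : 5 / 9 < Real.cos θ) (hθ : |θ| ≤ 2 * Real.pi - 1) : |θ| < 1 := by
  by_contra! h1
  have := cos_le_cos_of_mem (zero_le_one' ℝ) h1 hθ
  rw [Real.cos_abs] at this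
  linarith [Real.cos_one_le]

/-- The quotient exp(z - w) is close to 1, so its argument is small modulo 2π. The value 5/9 is
chosen as a rational upper bound for cos 1. -/
lemma five_ninths_lt_cos_of_norm_exp_sub_le {z w : ℂ}
    (h : ‖Complex.exp z - Complex.exp w‖ ≤ 1 / 16 * (Real.exp z.re + Real.exp w.re)) :
    5 / 9 < Real.cos (z.im - w.im) := by
  have e : Complex.exp (z - w) - 1 = (Complex.exp z - Complex.exp w) / Complex.exp w := by
    rw [Complex.exp_sub]
    field_simp [Complex.exp_ne_zero]
  have hq : ‖Complex.exp (z - w) - 1‖ ≤ 1 / 16 * (Real.exp (z - w).re + 1) := by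
    rw [e, norm_div, Complex.norm_exp, div_le_iff₀ (Real.exp_pos _)]
    refine h.trans_eq ?_
    rw [Complex.sub_re, Real.exp_sub]
    field_simp
  have hr := (Complex.abs_re_le_norm _).trans hq
  have hn : Real.exp (z - w).re - 1 ≤ 1 / 16 * (Real.exp (z - w).re + 1) := by
    refine le_trans ?_ hq
    rw [← Complex.norm_exp]
    simpa using norm_sub_norm_le (Complex.exp (z - w)) 1
  rw [Complex.sub_re, Complex.exp_re, Complex.one_re, Complex.sub_im] at hr
  have hr' := (abs_le.1 hr).1
  have hpos := Real.exp_pos (z - w).re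
  by_contra! hc
  nlinarith

/-- Every half-strip contains points `z` far to the right for which `expSum p z` has no other
preimage in this half-strip. -/
lemma exists_base_point {p m : ℕ} (hp : 3 ≤ p) (hm : 1 ≤ m) {α : ℝ} (hα : |α| ≤ Real.pi / 4) :
    ∃ z₀ ∈ halfStrip p m, z₀.im = m * (2 * Real.pi) + α ∧
      ‖expSum p z₀ - Complex.exp z₀‖ ≤ 1 / 16 * Real.exp z₀.re ∧
      ∀ z ∈ halfStrip p m, expSum p z = expSum p z₀ → z = z₀ := by
  have hpi := Real.pi_gt_three
  have hpi4 := Real.pi_le_four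
  have hm1 : (1 : ℝ) ≤ m := by exact_mod_cast hm
  have hs := sin_angle_pos hp
  have hα' := abs_le.1 hα
  set Y := (2 * (m : ℝ) + 1) * Real.pi + 2 with hY
  obtain ⟨X, hX0, hX⟩ := exists_forall_norm_sub_exp_le hp Y (ε := 1 / 16) (by norm_num)
  set y₀ := (m : ℝ) * (2 * Real.pi) + α with hy₀
  set B := (p : ℝ) * Real.exp (X + Y) with hB
  -- The three bounds ensure, in turn, that f is close to exp at z₀, that |f(z₀)| exceeds every
  -- value of |f| at points of the half-strip with Re z < X, and that z₀ lies in the sector.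
  obtain ⟨t, ht⟩ : ∃ t : ℝ, t = max X (max (2 * B) (y₀ / Real.sin (Real.pi / p) + 1)) := ⟨_, rfl⟩
  have htX : X ≤ t := ht ▸ le_max_left _ _
  have htB : 2 * B ≤ t := ht ▸ (le_max_left _ _).trans (le_max_right _ _)
  have hty : y₀ / Real.sin (Real.pi / p) + 1 ≤ t :=
    ht ▸ (le_max_right _ _).trans (le_max_right _ _)
  have hy₀0 : 0 < y₀ := by nlinarith
  have hy₀Y : |y₀| ≤ Y := by
    rw [abs_of_pos hy₀0, hY]
    linarith
  have hz₀S : (⟨t, y₀⟩ : ℂ) ∈ halfStrip p m := by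
    refine ⟨?_, ?_, ?_⟩
    · change _ < y₀
      linarith
    · change y₀ < _
      linarith
    · change y₀ * _ < t * _
      have h1 : y₀ / Real.sin (Real.pi / p) < t := by linarith
      rw [div_lt_iff₀ hs] at h1
      have := Real.cos_le_one (Real.pi / p)
      nlinarith
  have hz₀X := hX ⟨t, y₀⟩ hy₀Y htX
  refine ⟨⟨t, y₀⟩, hz₀S, rfl, hz₀X.1, fun z hz hzz => ?_⟩
  have hz' := halfStrip_subset_closedHalfStrip p m hz
  have him : |z.im| ≤ Y := (halfStrip_abs_im_le hz' hm).trans (by linarith)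
  have hzX : X ≤ z.re := by
    by_contra! h
    have h1 := norm_expSum_ge hz₀X.1
    have h2 := norm_expSum_le p z
    rw [hzz] at h2
    have h3 : ‖z‖ ≤ X + Y := by
      refine (Complex.norm_le_abs_re_add_abs_im z).trans (add_le_add ?_ him)
      rw [abs_of_pos (halfStrip_re_pos hp hz' hm)]
      exact h.le
    have h4 : (p : ℝ) * Real.exp ‖z‖ ≤ B := by rw [hB]; gcongr
    have h5 := Real.add_one_le_exp t
    change 1 / 2 * Real.exp t ≤ _ at h1
    linarith
  have hzX' := hX z him hzX
  have hcos : 5 / 9 < Real.cos (z.im - y₀) := by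
    refine five_ninths_lt_cos_of_norm_exp_sub_le (z := z) (w := ⟨t, y₀⟩) ?_
    have e : Complex.exp z - Complex.exp ⟨t, y₀⟩ =
        (expSum p ⟨t, y₀⟩ - Complex.exp ⟨t, y₀⟩) - (expSum p z - Complex.exp z) := by
      rw [hzz]; ring
    rw [e]
    refine (norm_sub_le _ _).trans ?_
    linarith [hz₀X.1, hzX'.1]
  -- Since |α| ≤ π/4, the two heights differ by at most 5π/4 < 2π - 1, so a large cosine leaves no
  -- other possibility.
  have hlt : |z.im - y₀| < 1 := by
    refine abs_lt_one_of_cos hcos (abs_le.2 ⟨?_, ?_⟩)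
    · linarith [hz.1]
    · linarith [hz.2.1]
  by_contra hne
  -- On the segment from z₀ to z the argument of exp stays within 1 of y₀, and f' is close to exp.
  -- Rotation by -y₀ makes its real part positive.
  refine ne_of_re_mul_deriv_pos (hasDerivAt_expSum p) (c := Complex.exp (-(y₀ : ℂ) * Complex.I))
    (Ne.symm hne) ?_ hzz.symm
  intro s hs'
  set x : ℂ := ⟨t, y₀⟩ + s * (z - ⟨t, y₀⟩) with hx
  have hxre : x.re = t + s * (z.re - t) := by simp [hx]
  have hxim : x.im = y₀ + s * (z.im - y₀) := by simp [hx]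
  have hxX : X ≤ x.re := by
    rw [hxre]
    nlinarith [hs'.1, hs'.2]
  have hd : |x.im - y₀| < 1 := by
    rw [hxim, add_sub_cancel_left, abs_mul, abs_of_pos hs'.1]
    nlinarith [hs'.1, hs'.2, abs_nonneg (z.im - y₀)]
  have hxY : |x.im| ≤ Y := by
    have h1 := abs_lt.1 hd
    rw [abs_le]
    constructor <;> linarith
  have hb := (hX x hxY hxX).2
  have hcx : 1 / 2 < Real.cos (x.im - y₀) := by
    have h1 : Real.cos 1 ≤ Real.cos (x.im - y₀) := by
      rw [← Real.cos_abs (x.im - y₀)]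
      exact Real.cos_le_cos_of_nonneg_of_le_pi (abs_nonneg _) (by linarith) hd.le
    have h2 : Real.cos (Real.pi / 3) ≤ Real.cos 1 :=
      Real.cos_le_cos_of_nonneg_of_le_pi zero_le_one (by linarith) (by linarith)
    have h3 : Real.cos (Real.pi / 3) < Real.cos 1 :=
      Real.cos_lt_cos_of_nonneg_of_le_pi zero_le_one (by linarith) (by linarith)
    rw [Real.cos_pi_div_three] at h3
    linarith
  have hnorm : ‖Complex.exp (-(y₀ : ℂ) * Complex.I)‖ = 1 := by
    have := Complex.norm_exp_ofReal_mul_I (-y₀)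
    simpa using this
  have e1 : (Complex.exp (-(y₀ : ℂ) * Complex.I) * Complex.exp x).re =
      Real.exp x.re * Real.cos (x.im - y₀) := by
    rw [← Complex.exp_add, Complex.exp_re]
    congr 2
    · simp
    · simp
      ring
  have e2 : |(Complex.exp (-(y₀ : ℂ) * Complex.I) * (expSumDeriv p x - Complex.exp x)).re| ≤
      1 / 16 * Real.exp x.re := by
    refine (Complex.abs_re_le_norm _).trans ?_
    rw [norm_mul, hnorm, one_mul]
    exact hb
  have e3 : Complex.exp (-(y₀ : ℂ) * Complex.I) * expSumDeriv p x =
      Complex.exp (-(y₀ : ℂ) * Complex.I) * Complex.exp x +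
      Complex.exp (-(y₀ : ℂ) * Complex.I) * (expSumDeriv p x - Complex.exp x) := by ring
  rw [e3, Complex.add_re, e1]
  have := (abs_le.1 e2).1
  nlinarith [Real.exp_pos x.re]

/-- The part of the right half-plane above (`ε = 1`) or below (`ε = -1`) the real axis. -/
def quadrant (ε : ℝ) : Set ℂ := {w | 0 < w.re ∧ 0 < ε * w.im}

lemma isOpen_quadrant (ε : ℝ) : IsOpen (quadrant ε) :=
  (isOpen_lt continuous_const Complex.continuous_re).inter
    (isOpen_lt continuous_const (Complex.continuous_im.const_mul _))

lemma convex_quadrant_ge (ε a : ℝ) : Convex ℝ {w : ℂ | a ≤ w.re ∧ a ≤ ε * w.im} := by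
  have h1 : Convex ℝ {w : ℂ | a ≤ w.re} := convex_halfSpace_re_ge a
  have h2 : Convex ℝ {w : ℂ | a ≤ ε * w.im} :=
    convex_halfSpace_ge (𝕜 := ℝ) (f := fun w : ℂ => ε * w.im)
      ⟨fun x y => by simp [mul_add], fun c x => by simp; ring⟩ a
  exact h1.inter h2

lemma convex_quadrant (ε : ℝ) : Convex ℝ (quadrant ε) := by
  have h1 : Convex ℝ {w : ℂ | 0 < w.re} := convex_halfSpace_re_gt 0
  have h2 : Convex ℝ {w : ℂ | 0 < ε * w.im} :=
    convex_halfSpace_gt (𝕜 := ℝ) (f := fun w : ℂ => ε * w.im)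
      ⟨fun x y => by simp [mul_add], fun c x => by simp; ring⟩ 0
  exact h1.inter h2

/-- Taking α = ±π/4 puts exp z₀ on the diagonal of the chosen quadrant, far enough from its edges
for f(z₀) to lie in it as well. -/
lemma exists_existsUnique_halfStrip {p m : ℕ} (hp : 3 ≤ p) (hm : 1 ≤ m) {ε : ℝ}
    (hε : ε = 1 ∨ ε = -1) :
    ∃ w₀ ∈ quadrant ε, ∃! z, z ∈ halfStrip p m ∧ expSum p z = w₀ := by
  have hpi := Real.pi_pos
  have hε1 : |ε| = 1 := by rcases hε with rfl | rfl <;> simp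
  obtain ⟨z₀, hz₀, him, hclose, huniq⟩ := exists_base_point hp hm (α := ε * (Real.pi / 4))
    (by rw [abs_mul, hε1, one_mul, abs_of_pos (by positivity)])
  refine ⟨expSum p z₀, ?_, z₀, ⟨hz₀, rfl⟩, fun z hz => huniq z hz.1 hz.2⟩
  have hcs : (1 : ℝ) / 2 < Real.sqrt 2 / 2 := by
    have : (1 : ℝ) < Real.sqrt 2 := by
      rw [Real.lt_sqrt] <;> norm_num
    linarith
  have hpos := Real.exp_pos z₀.re
  have hcos : Real.cos z₀.im = Real.sqrt 2 / 2 := by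
    rw [him, add_comm, Real.cos_add_nat_mul_two_pi]
    rcases hε with rfl | rfl <;> simp
  have hsin : ε * Real.sin z₀.im = Real.sqrt 2 / 2 := by
    rw [him, add_comm, Real.sin_add_nat_mul_two_pi]
    rcases hε with rfl | rfl <;> simp
  have hre := (abs_le.1 ((Complex.abs_re_le_norm _).trans hclose)).1
  have him' : |ε * (expSum p z₀ - Complex.exp z₀).im| ≤ 1 / 16 * Real.exp z₀.re := by
    rw [abs_mul, hε1, one_mul]
    exact (Complex.abs_im_le_norm _).trans hclose
  have him2 := (abs_le.1 him').1
  rw [Complex.sub_re, Complex.exp_re, hcos] at hre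
  have e : ε * (expSum p z₀ - Complex.exp z₀).im =
      ε * (expSum p z₀).im - Real.exp z₀.re * (ε * Real.sin z₀.im) := by
    rw [Complex.sub_im, Complex.exp_im]; ring
  rw [e, hsin] at him2
  have := mul_lt_mul_of_pos_left hcs hpos
  exact ⟨by linarith, by linarith⟩

/-- For large `m`, the map `expSum p` has an inverse branch from each of the two quadrants to the
half-strip with number `m`. -/
lemma exists_halfStrip_branch {p : ℕ} (hp : 3 ≤ p) :
    ∃ m₀ : ℕ, 1 ≤ m₀ ∧ ∀ m, m₀ ≤ m →
      (∀ z ∈ closedHalfStrip p m, 0 < (expSum p z).re → (expSum p z).im ≠ 0 →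
        z ∈ halfStrip p m) ∧
      ∀ ε : ℝ, ε = 1 ∨ ε = -1 → ∃ g : ℂ → ℂ,
        (∀ w ∈ quadrant ε, g w ∈ halfStrip p m ∧ expSum p (g w) = w ∧
          HasDerivAt g (expSumDeriv p (g w))⁻¹ w ∧ expSumDeriv p (g w) ≠ 0) ∧
        ∀ z ∈ halfStrip p m, expSum p z ∈ quadrant ε → g (expSum p z) = z := by
  obtain ⟨m₀, hm₀, h⟩ := exists_forall_halfStrip hp
  refine ⟨m₀, hm₀, fun m hm => ⟨(h m hm).2, fun ε hε => ?_⟩⟩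
  obtain ⟨hne, hmem⟩ := h m hm
  have hm1 := hm₀.trans hm
  obtain ⟨w₀, hw₀, huniq⟩ := exists_existsUnique_halfStrip hp hm1 hε
  have hmem' : ∀ z ∈ closedHalfStrip p m, expSum p z ∈ quadrant ε → z ∈ halfStrip p m :=
    fun z hz hq => hmem z hz hq.1 fun h0 => by simpa [h0] using hq.2
  obtain ⟨g, hg, hg'⟩ := exists_inverse_branch (hasDerivAt_expSum p) (isOpen_halfStrip p m) hne
    (isOpen_quadrant ε) fun w hw => existsUnique_of_proper (hasDerivAt_expSum p)
      (isOpen_halfStrip p m) (isClosed_closedHalfStrip p m) (halfStrip_subset_closedHalfStrip p m)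
      (convex_quadrant ε).isPreconnected hmem' hne (isBounded_closedHalfStrip_inter hp hm1)
      hw₀ huniq hw
  exact ⟨g, fun w hw => ⟨(hg w hw).1, (hg w hw).2.1, (hg w hw).2.2, hne _ (hg w hw).1⟩, hg'⟩

lemma ball_subset_quadrant {ε d : ℝ} (hε : ε = 1 ∨ ε = -1) {w : ℂ} (h1 : d ≤ w.re)
    (h2 : d ≤ ε * w.im) : Metric.ball w d ⊆ quadrant ε := by
  intro x hx
  have hx' : ‖x - w‖ < d := by simpa [dist_eq_norm] using hx
  have hre := (abs_lt.1 ((Complex.abs_re_le_norm _).trans_lt hx')).1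
  have hε1 : |ε| = 1 := by rcases hε with rfl | rfl <;> simp
  have him : |ε * (x - w).im| < d := by
    rw [abs_mul, hε1, one_mul]
    exact (Complex.abs_im_le_norm _).trans_lt hx'
  have him' := (abs_lt.1 him).1
  rw [Complex.sub_re] at hre
  rw [Complex.sub_im, mul_sub] at him'
  exact ⟨by linarith, by linarith⟩

/-! ### Expansion on the half-strips in both half-planes. -/

/-- The properties of a half-strip `S` with closure `T` on which the construction of points with a
given itinerary rests: `expSum p` covers both quadrants, has large derivative at, and expands the
distances between, the points that are mapped far into one of the quadrants. -/
structure IsExpandingPiece (p : ℕ) (S T : Set ℂ) : Prop where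
  surj : ∀ w : ℂ, 0 < w.re → w.im ≠ 0 → ∃ z ∈ S, expSum p z = w
  norm_sub_le : ∀ d ε : ℝ, 0 < d → ε = 1 ∨ ε = -1 → ∀ z ∈ S, ∀ w ∈ S,
    d ≤ (expSum p z).re → d ≤ ε * (expSum p z).im →
    d ≤ (expSum p w).re → d ≤ ε * (expSum p w).im →
    ‖z - w‖ ≤ 8 * Real.pi / d * ‖expSum p z - expSum p w‖
  le_norm_deriv : ∀ d ε : ℝ, 0 < d → ε = 1 ∨ ε = -1 → ∀ z ∈ S,
    d ≤ (expSum p z).re → d ≤ ε * (expSum p z).im → d ≤ 8 * Real.pi * ‖expSumDeriv p z‖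
  mem : ∀ z ∈ T, 0 < (expSum p z).re → (expSum p z).im ≠ 0 → z ∈ S

/-- A disc of radius d about a point of depth d lies in the quadrant, so the branch has derivative
at most 8π/d there. The points of depth at least d form a convex set, which turns this into a
Lipschitz bound. -/
lemma exists_isExpandingPiece_halfStrip {p : ℕ} (hp : 3 ≤ p) :
    ∃ m₀ : ℕ, 1 ≤ m₀ ∧ ∀ m, m₀ ≤ m →
      IsExpandingPiece p (halfStrip p m) (closedHalfStrip p m) := by
  obtain ⟨m₀, hm₀, h⟩ := exists_halfStrip_branch hp
  refine ⟨m₀, hm₀, fun m hm => ?_⟩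
  obtain ⟨hmem, hbr⟩ := h m hm
  have hbound : ∀ d ε : ℝ, 0 < d → (hε : ε = 1 ∨ ε = -1) → ∀ g : ℂ → ℂ,
      (∀ w ∈ quadrant ε, g w ∈ halfStrip p m ∧ expSum p (g w) = w ∧
          HasDerivAt g (expSumDeriv p (g w))⁻¹ w ∧ expSumDeriv p (g w) ≠ 0) →
      ∀ w : ℂ, d ≤ w.re → d ≤ ε * w.im → ‖(expSumDeriv p (g w))⁻¹‖ ≤ 8 * Real.pi / d := by
    intro d ε hd hε g hg w h1 h2
    have hball := ball_subset_quadrant hε h1 h2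
    refine norm_deriv_le_of_mapsTo_strip hd (a := (2 * (m : ℝ) - 1) * Real.pi)
      (fun x hx => (hg x (hball hx)).2.2.1.differentiableAt.differentiableWithinAt)
      (hg w (hball (Metric.mem_ball_self hd))).2.2.1 fun x hx => ?_
    have := (hg x (hball hx)).1
    exact ⟨this.1, by linarith [this.2.1]⟩
  refine ⟨fun w hre him => ?_, ?_, ?_, hmem⟩
  · obtain ⟨ε, hε, hpos⟩ : ∃ ε : ℝ, (ε = 1 ∨ ε = -1) ∧ 0 < ε * w.im := by
      rcases lt_or_gt_of_ne him with h | h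
      · exact ⟨-1, Or.inr rfl, by linarith⟩
      · exact ⟨1, Or.inl rfl, by linarith⟩
    obtain ⟨g, hg, -⟩ := hbr ε hε
    have := hg w ⟨hre, hpos⟩
    exact ⟨g w, this.1, this.2.1⟩
  · intro d ε hd hε z hz w hw hz1 hz2 hw1 hw2
    obtain ⟨g, hg, hg'⟩ := hbr ε hε
    have hq : ∀ x : ℂ, d ≤ x.re → d ≤ ε * x.im → x ∈ quadrant ε := fun x h1 h2 =>
      ball_subset_quadrant hε h1 h2 (Metric.mem_ball_self hd)
    have := (convex_quadrant_ge ε d).norm_image_sub_le_of_norm_hasDerivWithin_le (f := g)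
      (f' := fun x => (expSumDeriv p (g x))⁻¹) (C := 8 * Real.pi / d)
      (fun x hx => (hg x (hq x hx.1 hx.2)).2.2.1.hasDerivWithinAt)
      (fun x hx => hbound d ε hd hε g hg x hx.1 hx.2)
      (show expSum p w ∈ _ from ⟨hw1, hw2⟩) (show expSum p z ∈ _ from ⟨hz1, hz2⟩)
    rwa [hg' z hz (hq _ hz1 hz2), hg' w hw (hq _ hw1 hw2)] at this
  · intro d ε hd hε z hz hz1 hz2
    obtain ⟨g, hg, hg'⟩ := hbr ε hε
    have hq := ball_subset_quadrant hε hz1 hz2 (Metric.mem_ball_self hd)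
    have h1 := hbound d ε hd hε g hg _ hz1 hz2
    have h2 := (hg _ hq).2.2.2
    rw [hg' z hz hq] at h1 h2
    have h3 : 0 < ‖expSumDeriv p z‖ := norm_pos_iff.2 h2
    rw [norm_inv, inv_le_comm₀ h3 (by have := Real.pi_pos; positivity), inv_div,
      div_le_iff₀ (by have := Real.pi_pos; positivity)] at h1
    linarith

lemma IsExpandingPiece.conj {p : ℕ} (hp : p ≠ 0) {S T : Set ℂ} (h : IsExpandingPiece p S T) :
    IsExpandingPiece p (starRingEnd ℂ ⁻¹' S) (starRingEnd ℂ ⁻¹' T) := by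
  have hneg : ∀ ε : ℝ, ε = 1 ∨ ε = -1 → -ε = 1 ∨ -ε = -1 := by
    rintro ε (rfl | rfl) <;> simp
  refine ⟨fun w hre him => ?_, ?_, ?_, ?_⟩
  · obtain ⟨z, hz, hzw⟩ := h.surj ((starRingEnd ℂ) w) (by simpa using hre) (by simpa using him)
    refine ⟨(starRingEnd ℂ) z, by simpa using hz, ?_⟩
    rw [expSum_conj hp, hzw, Complex.conj_conj]
  · intro d ε hd hε z hz w hw hz1 hz2 hw1 hw2
    have := h.norm_sub_le d (-ε) hd (hneg ε hε) _ hz _ hw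
    simp only [expSum_conj hp, Complex.conj_re, Complex.conj_im, neg_mul_neg, ← map_sub,
      Complex.norm_conj] at this
    exact this hz1 hz2 hw1 hw2
  · intro d ε hd hε z hz hz1 hz2
    have := h.le_norm_deriv d (-ε) hd (hneg ε hε) _ hz
    simp only [expSum_conj hp, expSumDeriv_conj hp, Complex.conj_re, Complex.conj_im, neg_mul_neg,
      Complex.norm_conj] at this
    exact this hz1 hz2
  · intro z hz hre him
    refine h.mem _ hz ?_ ?_
    · rwa [expSum_conj hp, Complex.conj_re]
    · rwa [expSum_conj hp, Complex.conj_im, neg_ne_zero]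

/-- The half-strip of number `k`, in the upper half-plane for `k > 0` and in the lower one for
`k < 0`. -/
def signedHalfStrip (p : ℕ) (k : ℤ) : Set ℂ :=
  {z | z ∈ strip k ∧ |z.im| * Real.cos (Real.pi / p) < z.re * Real.sin (Real.pi / p)}

/-- The closed version of `signedHalfStrip`. -/
def closedSignedHalfStrip (p : ℕ) (k : ℤ) : Set ℂ :=
  {z | (2 * (k : ℝ) - 1) * Real.pi ≤ z.im ∧ z.im ≤ (2 * (k : ℝ) + 1) * Real.pi ∧
    |z.im| * Real.cos (Real.pi / p) ≤ z.re * Real.sin (Real.pi / p)}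

lemma signedHalfStrip_natCast (p : ℕ) {m : ℕ} (hm : 1 ≤ m) :
    signedHalfStrip p m = halfStrip p m ∧ closedSignedHalfStrip p m = closedHalfStrip p m := by
  have hm1 : (1 : ℝ) ≤ m := by exact_mod_cast hm
  have hpos : ∀ y : ℝ, (2 * (m : ℝ) - 1) * Real.pi ≤ y → |y| = y := fun y hy =>
    abs_of_nonneg (by nlinarith [Real.pi_pos])
  constructor
  · ext z
    simp only [signedHalfStrip, halfStrip, strip, Set.mem_ofPred_eq, Int.cast_natCast, and_assoc]
    refine and_congr_right fun h => ?_
    rw [hpos _ h.le]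
  · ext z
    simp only [closedSignedHalfStrip, closedHalfStrip, Set.mem_ofPred_eq, Int.cast_natCast]
    refine and_congr_right fun h => ?_
    rw [hpos _ h]

lemma signedHalfStrip_neg (p : ℕ) (k : ℤ) :
    signedHalfStrip p (-k) = starRingEnd ℂ ⁻¹' signedHalfStrip p k ∧
      closedSignedHalfStrip p (-k) = starRingEnd ℂ ⁻¹' closedSignedHalfStrip p k := by
  constructor
  · ext z
    simp only [signedHalfStrip, strip, Set.mem_ofPred_eq, Set.mem_preimage, Complex.conj_re,
      Complex.conj_im, abs_neg, Int.cast_neg]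
    refine and_congr_left fun _ => ⟨fun h => ⟨?_, ?_⟩, fun h => ⟨?_, ?_⟩⟩ <;>
      linarith [h.1, h.2]
  · ext z
    simp only [closedSignedHalfStrip, Set.mem_ofPred_eq, Set.mem_preimage, Complex.conj_re,
      Complex.conj_im, abs_neg, Int.cast_neg, ← and_assoc]
    refine and_congr_left fun _ => ⟨fun h => ⟨?_, ?_⟩, fun h => ⟨?_, ?_⟩⟩ <;>
      linarith [h.1, h.2]

lemma exists_isExpandingPiece {p : ℕ} (hp : 3 ≤ p) :
    ∃ m₀ : ℕ, 1 ≤ m₀ ∧ ∀ k : ℤ, (m₀ : ℤ) ≤ |k| →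
      IsExpandingPiece p (signedHalfStrip p k) (closedSignedHalfStrip p k) := by
  obtain ⟨m₀, hm₀, h⟩ := exists_isExpandingPiece_halfStrip hp
  have hnat : ∀ m : ℕ, m₀ ≤ m →
      IsExpandingPiece p (signedHalfStrip p m) (closedSignedHalfStrip p m) := fun m hm => by
    rw [(signedHalfStrip_natCast p (hm₀.trans hm)).1, (signedHalfStrip_natCast p (hm₀.trans hm)).2]
    exact h m hm
  refine ⟨m₀, hm₀, fun k hk => ?_⟩
  obtain ⟨m, rfl | rfl⟩ := Int.eq_nat_or_neg k
  · exact hnat m (by simpa using hk)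
  · rw [(signedHalfStrip_neg p m).1, (signedHalfStrip_neg p m).2]
    exact (hnat m (by simpa using hk)).conj (by omega)

/-! ### Trapezia and symbols. -/

/-- A point of the closed half-strip of number `k` lies deep in one of the quadrants. -/
lemma le_of_mem_closedSignedHalfStrip {p M : ℕ} (hp : 3 ≤ p) (hM : 1 ≤ M) {k : ℤ}
    (hk : (M : ℤ) ≤ |k|) {z : ℂ} (hz : z ∈ closedSignedHalfStrip p k) :
    M * Real.pi / 2 ≤ z.re ∧ M * Real.pi / 2 ≤ (if 0 < k then 1 else -1) * z.im := by
  have hM1 : (1 : ℝ) ≤ M := by exact_mod_cast hM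
  have hpi := Real.pi_pos
  have him : M * Real.pi ≤ (if 0 < k then 1 else -1) * z.im := by
    split_ifs with h
    · have : (M : ℝ) ≤ k := by rw [abs_of_pos h] at hk; exact_mod_cast hk
      have := hz.1
      nlinarith
    · have : (M : ℝ) ≤ -k := by rw [abs_of_nonpos (not_lt.1 h)] at hk; exact_mod_cast hk
      have := hz.2.1
      nlinarith
  have habs : M * Real.pi ≤ |z.im| := by
    refine him.trans ((le_abs_self _).trans_eq ?_)
    rw [abs_mul]
    split_ifs <;> simp
  refine ⟨?_, by nlinarith⟩
  have h1 := hz.2.2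
  -- The depth is halved because cos(π/p) is only known to be at least 1/2, the value at p = 3.
  have hc := cos_angle_ge hp
  have hs := sin_angle_pos hp
  have hs1 := Real.sin_le_one (Real.pi / p)
  have h2 : M * Real.pi / 2 ≤ z.re * Real.sin (Real.pi / p) := by
    linarith [mul_le_mul_of_nonneg_left hc (abs_nonneg z.im)]
  have h3 : 0 ≤ z.re := by
    by_contra! h
    nlinarith
  nlinarith

/-- The trapezium cut off the closed half-strip of number `k` by the line `x = c`. -/
def signedTrapezium (p : ℕ) (c : ℝ) (k : ℤ) : Set ℂ :=
  closedSignedHalfStrip p k ∩ {z | z.re ≤ c}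

lemma isClosed_signedTrapezium (p : ℕ) (c : ℝ) (k : ℤ) : IsClosed (signedTrapezium p c k) :=
  ((isClosed_le continuous_const Complex.continuous_im).inter
    ((isClosed_le Complex.continuous_im continuous_const).inter
      (isClosed_le (Complex.continuous_im.abs.mul_const _)
        (Complex.continuous_re.mul_const _)))).inter
    (isClosed_le Complex.continuous_re continuous_const)

lemma mem_trapezium_iff {p m : ℕ} {c : ℝ} (hp : 3 ≤ p) (hm : 1 ≤ m) {z : ℂ} :
    z ∈ trapezium p m c ↔ z ∈ signedTrapezium p c m := by
  rw [signedTrapezium, (signedHalfStrip_natCast p hm).2]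
  have hc : 0 < Real.cos (Real.pi / p) := by linarith [cos_angle_ge hp]
  simp only [trapezium, closedHalfStrip, Set.mem_inter_iff, Set.mem_ofPred_eq, and_assoc]
  refine and_congr_right fun _ => and_congr_right fun _ => and_congr_left fun _ => ?_
  rw [Real.tan_eq_sin_div_cos, div_mul_eq_mul_div, le_div_iff₀ hc, mul_comm z.re]

lemma mem_trapeziumUnion_iff {p M K : ℕ} {c : ℝ} (hp : 3 ≤ p) (hM : 1 ≤ M) {z : ℂ} :
    z ∈ trapeziumUnion p M K c ↔
      ∃ k : ℤ, (M : ℤ) ≤ |k| ∧ |k| < M + K ∧ z ∈ signedTrapezium p c k := by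
  constructor
  · rintro ⟨m, hm, hmK, h | h⟩
    · exact ⟨m, by simpa using hm, by simpa using by exact_mod_cast hmK,
        (mem_trapezium_iff hp (hM.trans hm)).1 h⟩
    · refine ⟨-m, by simpa using hm, by simpa using by exact_mod_cast hmK, ?_⟩
      rw [mem_trapezium_iff hp (hM.trans hm)] at h
      rw [signedTrapezium, (signedHalfStrip_neg p m).2]
      exact ⟨h.1, by simpa using h.2⟩
  · rintro ⟨k, hk, hkK, hz⟩
    obtain ⟨m, rfl | rfl⟩ := Int.eq_nat_or_neg k
    · have hm : M ≤ m := by simpa using hk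
      refine ⟨m, hm, by rw [Nat.abs_cast] at hkK; exact_mod_cast hkK, Or.inl ?_⟩
      exact (mem_trapezium_iff hp (hM.trans hm)).2 hz
    · have hm : M ≤ m := by simpa using hk
      refine ⟨m, hm, by rw [abs_neg, Nat.abs_cast] at hkK; exact_mod_cast hkK, Or.inr ?_⟩
      rw [mem_trapezium_iff hp (hM.trans hm)]
      rw [signedTrapezium, (signedHalfStrip_neg p m).2] at hz
      exact ⟨hz.1, by simpa using hz.2⟩

lemma eq_of_mem_strip {k l : ℤ} {z : ℂ} (hk : z ∈ strip k)
    (h1 : (2 * (l : ℝ) - 1) * Real.pi ≤ z.im) (h2 : z.im ≤ (2 * (l : ℝ) + 1) * Real.pi) :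
    k = l := by
  have hpi := Real.pi_pos
  have a : (2 * (k : ℝ) - 1) < 2 * (l : ℝ) + 1 := lt_of_mul_lt_mul_right (hk.1.trans_le h2) hpi.le
  have b : (2 * (l : ℝ) - 1) < 2 * (k : ℝ) + 1 := lt_of_mul_lt_mul_right (h1.trans_lt hk.2) hpi.le
  have a' : 2 * k - 1 < 2 * l + 1 := by exact_mod_cast a
  have b' : 2 * l - 1 < 2 * k + 1 := by exact_mod_cast b
  omega

lemma abs_stripIndex {M : ℕ} (hM : 1 ≤ M) {j : ℤ} (hj : 1 ≤ |j|) :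
    |stripIndex M j| = |j| + (M - 1) := by
  have hM1 : (1 : ℤ) ≤ M := by exact_mod_cast hM
  unfold stripIndex
  split_ifs with h
  · rw [abs_of_pos h, abs_of_pos (by omega)]
  · have h' : j ≤ 0 := not_lt.1 h
    rw [abs_of_nonpos h'] at hj ⊢
    rw [abs_of_nonpos (by omega)]
    ring

lemma stripIndex_injOn {M : ℕ} (hM : 1 ≤ M) {i j : ℤ} (hi : 1 ≤ |i|) (hj : 1 ≤ |j|)
    (h : stripIndex M i = stripIndex M j) : i = j := by
  have hM1 : (1 : ℤ) ≤ M := by exact_mod_cast hM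
  unfold stripIndex at h
  rcases abs_cases i with ⟨a, b⟩ | ⟨a, b⟩ <;> rcases abs_cases j with ⟨c, d⟩ | ⟨c, d⟩ <;>
    split_ifs at h <;> omega

lemma shift_iterate_apply (n : ℕ) (s : ℕ → ℤ) (i : ℕ) : shift^[n] s i = s (i + n) := by
  induction n generalizing s with
  | zero => rfl
  | succ n ih => rw [Function.iterate_succ_apply, ih]; exact congrArg s (by ring)

/-! ### Coding: existence, uniqueness and expansion. -/

/-- The points of the sectors `|arg z| ≤ π / p` whose orbits stay in the prescribed trapezia. -/
def FollowsTrapezia (p : ℕ) (c : ℝ) (k : ℕ → ℤ) (z : ℂ) : Prop :=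
  ∀ n, (expSum p)^[n] z ∈ signedTrapezium p c (k n)

section Coding

variable {p M : ℕ} {c : ℝ} {k : ℕ → ℤ}

/-- The next iterate lies inside an open quadrant, and no boundary point of the half-strip is mapped
there. Hence closed trapezia, needed for compactness, lose nothing against open strips. -/
lemma FollowsTrapezia.mem_signedHalfStrip (hp : 3 ≤ p) (hM : 1 ≤ M)
    (hE : ∀ k : ℤ, (M : ℤ) ≤ |k| →
      IsExpandingPiece p (signedHalfStrip p k) (closedSignedHalfStrip p k))
    (hk : ∀ n, (M : ℤ) ≤ |k n|) {z : ℂ} (hz : FollowsTrapezia p c k z) (n : ℕ) :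
    (expSum p)^[n] z ∈ signedHalfStrip p (k n) := by
  have hM1 : (1 : ℝ) ≤ M := by exact_mod_cast hM
  have hd : 0 < (M : ℝ) * Real.pi / 2 := by have := Real.pi_pos; positivity
  obtain ⟨h1, h2⟩ := le_of_mem_closedSignedHalfStrip hp hM (hk (n + 1)) (hz (n + 1)).1
  rw [Function.iterate_succ_apply'] at h1 h2
  refine (hE _ (hk n)).mem _ (hz n).1 (hd.trans_le h1) fun h0 => ?_
  rw [h0, mul_zero] at h2
  exact absurd h2 (not_le.2 hd)

lemma mem_invariantSet_and_hasItinerary_iff {K : ℕ} (hp : 3 ≤ p) (hM : 1 ≤ M)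
    (hE : ∀ k : ℤ, (M : ℤ) ≤ |k| →
      IsExpandingPiece p (signedHalfStrip p k) (closedSignedHalfStrip p k))
    {s : ℕ → ℤ} (hs : s ∈ symbolSpace K) {z : ℂ} :
    (z ∈ invariantSet p M K c ∧ HasItinerary p M s z) ↔
      FollowsTrapezia p c (fun n => stripIndex M (s n)) z := by
  have habs := fun n => abs_stripIndex hM (hs n).1
  constructor
  · rintro ⟨h1, h2⟩ n
    obtain ⟨l, -, -, hl⟩ := (mem_trapeziumUnion_iff hp hM).1 (h1 n)
    have : stripIndex M (s n) = l := eq_of_mem_strip (h2 n) hl.1.1 hl.1.2.1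
    simpa only [this] using hl
  · intro h
    refine ⟨fun n => ?_, fun n => ?_⟩
    · refine (mem_trapeziumUnion_iff hp hM).2 ⟨stripIndex M (s n), ?_, ?_, h n⟩ <;>
        have := hs n <;> rw [habs] <;> omega
    · refine (h.mem_signedHalfStrip hp hM hE (fun n => ?_) n).1
      have := (hs n).1
      rw [habs]
      omega

lemma two_le_norm_expSumDeriv (hp : 3 ≤ p) (hM : 32 ≤ M)
    (hE : ∀ k : ℤ, (M : ℤ) ≤ |k| →
      IsExpandingPiece p (signedHalfStrip p k) (closedSignedHalfStrip p k))
    (hk : ∀ n, (M : ℤ) ≤ |k n|) {z : ℂ} (hz : FollowsTrapezia p c k z) (n : ℕ) :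
    2 ≤ ‖expSumDeriv p ((expSum p)^[n] z)‖ := by
  have hM1 : (32 : ℝ) ≤ M := by exact_mod_cast hM
  have hpi := Real.pi_pos
  obtain ⟨h1, h2⟩ := le_of_mem_closedSignedHalfStrip hp (by omega) (hk (n + 1)) (hz (n + 1)).1
  rw [Function.iterate_succ_apply'] at h1 h2
  have := (hE _ (hk n)).le_norm_deriv _ _ (by positivity) (by split_ifs <;> simp) _
    (hz.mem_signedHalfStrip hp (by omega) hE hk n) h1 h2
  nlinarith

lemma two_pow_le_norm_deriv_iterate (hp : 3 ≤ p) (hM : 32 ≤ M)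
    (hE : ∀ k : ℤ, (M : ℤ) ≤ |k| →
      IsExpandingPiece p (signedHalfStrip p k) (closedSignedHalfStrip p k))
    (hk : ∀ n, (M : ℤ) ≤ |k n|) {z : ℂ} (hz : FollowsTrapezia p c k z) (n : ℕ) :
    2 ^ n ≤ ‖deriv (expSum p)^[n] z‖ := by
  induction n with
  | zero => simp
  | succ n ih =>
    rw [Function.iterate_succ', deriv_comp _ (differentiable_expSum p _)
      ((differentiable_expSum p).iterate n _), norm_mul, deriv_expSum, pow_succ, mul_comm]
    have := two_le_norm_expSumDeriv hp hM hE hk hz n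
    gcongr

lemma norm_le_of_mem_signedTrapezium (hp : 3 ≤ p) (hM : 1 ≤ M) {Y : ℝ} {l : ℤ}
    (hl : (M : ℤ) ≤ |l|) (hY : (2 * (|l| : ℤ) + 1) * Real.pi ≤ Y) {z : ℂ}
    (hz : z ∈ signedTrapezium p c l) :
    0 < z.re ∧ z.im ≠ 0 ∧ |z.im| ≤ Y ∧ ‖z‖ ≤ c + Y := by
  have hM1 : (1 : ℝ) ≤ M := by exact_mod_cast hM
  have hpi := Real.pi_pos
  have hd : 0 < (M : ℝ) * Real.pi / 2 := by positivity
  obtain ⟨h1, h2⟩ := le_of_mem_closedSignedHalfStrip hp hM hl hz.1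
  have him : |z.im| ≤ Y := by
    refine le_trans (abs_le.2 ⟨?_, ?_⟩) hY
    · have := hz.1.1
      have h3 : -(l : ℝ) ≤ ((|l| : ℤ) : ℝ) := by exact_mod_cast neg_le_abs l
      nlinarith
    · have := hz.1.2.1
      have h3 : (l : ℝ) ≤ ((|l| : ℤ) : ℝ) := by exact_mod_cast le_abs_self l
      nlinarith
  refine ⟨hd.trans_le h1, fun h0 => ?_, him, ?_⟩
  · rw [h0, mul_zero] at h2
    linarith
  · refine (Complex.norm_le_abs_re_add_abs_im z).trans (add_le_add ?_ him)
    rw [abs_of_pos (hd.trans_le h1)]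
    exact hz.2

/-- Consecutive iterates of both points lie in the same quadrant, so distances at least double at
each step, yet they stay at most 2(c + Y). -/
lemma FollowsTrapezia.eq (hp : 3 ≤ p) (hM : 32 ≤ M)
    (hE : ∀ k : ℤ, (M : ℤ) ≤ |k| →
      IsExpandingPiece p (signedHalfStrip p k) (closedSignedHalfStrip p k))
    (hk : ∀ n, (M : ℤ) ≤ |k n|) {Y : ℝ} (hY : ∀ n, (2 * (|k n| : ℤ) + 1) * Real.pi ≤ Y) {z w : ℂ}
    (hz : FollowsTrapezia p c k z) (hw : FollowsTrapezia p c k w) : z = w := by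
  have hM1 : (32 : ℝ) ≤ M := by exact_mod_cast hM
  have hpi := Real.pi_pos
  have hstep : ∀ n, ‖(expSum p)^[n] z - (expSum p)^[n] w‖ ≤
      1 / 2 * ‖(expSum p)^[n + 1] z - (expSum p)^[n + 1] w‖ := by
    intro n
    obtain ⟨h1, h2⟩ := le_of_mem_closedSignedHalfStrip hp (by omega) (hk (n + 1)) (hz (n + 1)).1
    obtain ⟨h3, h4⟩ := le_of_mem_closedSignedHalfStrip hp (by omega) (hk (n + 1)) (hw (n + 1)).1
    rw [Function.iterate_succ_apply'] at h1 h2 h3 h4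
    rw [Function.iterate_succ_apply', Function.iterate_succ_apply']
    refine ((hE _ (hk n)).norm_sub_le _ _ (by positivity) (by split_ifs <;> simp) _
      (hz.mem_signedHalfStrip hp (by omega) hE hk n) _
      (hw.mem_signedHalfStrip hp (by omega) hE hk n) h1 h2 h3 h4).trans ?_
    refine mul_le_mul_of_nonneg_right ?_ (norm_nonneg _)
    rw [div_le_iff₀ (by positivity)]
    nlinarith
  have hpow : ∀ n, ‖z - w‖ ≤ (1 / 2) ^ n * ‖(expSum p)^[n] z - (expSum p)^[n] w‖ := by
    intro n
    induction n with
    | zero => simp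
    | succ n ih =>
      refine ih.trans ?_
      rw [pow_succ, mul_assoc]
      gcongr
      exact hstep n
  have hbound : ∀ n, ‖z - w‖ ≤ (1 / 2) ^ n * (2 * (c + Y)) := by
    intro n
    refine (hpow n).trans ?_
    gcongr
    refine (norm_sub_le _ _).trans ?_
    linarith [(norm_le_of_mem_signedTrapezium hp (by omega) (hk n) (hY n) (hz n)).2.2.2,
      (norm_le_of_mem_signedTrapezium hp (by omega) (hk n) (hY n) (hw n)).2.2.2]
  have hlim : Tendsto (fun n : ℕ => (1 / 2 : ℝ) ^ n * (2 * (c + Y))) atTop (𝓝 0) := by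
    have := (tendsto_pow_atTop_nhds_zero_of_lt_one (r := (1 / 2 : ℝ)) (by norm_num)
      (by norm_num)).mul_const (2 * (c + Y))
    simpa using this
  have := ge_of_tendsto' hlim hbound
  exact sub_eq_zero.1 (norm_le_zero_iff.1 this)

lemma exists_followsTrapezia (hp : 3 ≤ p) (hM : 1 ≤ M)
    (hE : ∀ k : ℤ, (M : ℤ) ≤ |k| →
      IsExpandingPiece p (signedHalfStrip p k) (closedSignedHalfStrip p k))
    (hk : ∀ n, (M : ℤ) ≤ |k n|) {Y : ℝ} (hY : ∀ n, (2 * (|k n| : ℤ) + 1) * Real.pi ≤ Y)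
    (hcY : 2 ≤ c + Y)
    (hfar : ∀ z : ℂ, |z.im| ≤ Y → c < z.re → c + Y < ‖expSum p z‖) :
    ∃ z, FollowsTrapezia p c k z := by
  have hfin : ∀ N : ℕ, ∀ l : ℕ → ℤ, (∀ n, (M : ℤ) ≤ |l n|) →
      (∀ n, (2 * (|l n| : ℤ) + 1) * Real.pi ≤ Y) → ∃ z : ℂ, (0 < z.re ∧ z.im ≠ 0 ∧ ‖z‖ ≤ c + Y) ∧
        ∀ n < N, (expSum p)^[n] z ∈ signedTrapezium p c (l n) := by
    intro N
    induction N with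
    | zero =>
      intro l _ _
      -- An arbitrary seed off the real axis in the right half-plane; only its norm bound c + Y
      -- matters for the pull-back.
      refine ⟨1 + Complex.I, ⟨by simp, by simp, ?_⟩, fun n hn => absurd hn (Nat.not_lt_zero n)⟩
      refine ((norm_add_le _ _).trans ?_).trans hcY
      rw [norm_one, Complex.norm_I]
      norm_num
    | succ N ih =>
      intro l hl hlY
      obtain ⟨w, ⟨hw1, hw2, hw3⟩, hw⟩ := ih (fun n => l (n + 1)) (fun n => hl _) (fun n => hlY _)
      obtain ⟨z, hz, hzw⟩ := (hE _ (hl 0)).surj w hw1 hw2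
      have hzc : z ∈ closedSignedHalfStrip p (l 0) := ⟨hz.1.1.le, hz.1.2.le, hz.2.le⟩
      have hzY := (norm_le_of_mem_signedTrapezium (c := z.re) hp hM (hl 0) (hlY 0)
        ⟨hzc, le_refl z.re⟩).2.2.1
      have hzT : z ∈ signedTrapezium p c (l 0) := by
        refine ⟨hzc, ?_⟩
        -- A preimage right of x = c would have an image of norm above c + Y, but w does not.
        by_contra hc
        have := hfar z hzY (not_le.1 hc)
        rw [hzw] at this
        linarith
      obtain ⟨g1, g2, -, g3⟩ := norm_le_of_mem_signedTrapezium hp hM (hl 0) (hlY 0) hzT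
      refine ⟨z, ⟨g1, g2, g3⟩, fun n hn => ?_⟩
      cases n with
      | zero => exact hzT
      | succ n =>
        rw [Function.iterate_succ_apply, hzw]
        exact hw n (by omega)
  have hcl : ∀ N : ℕ,
      IsClosed {z : ℂ | ∀ n < N + 1, (expSum p)^[n] z ∈ signedTrapezium p c (k n)} := by
    intro N
    simp only [Set.ofPred_forall]
    exact isClosed_iInter fun n => isClosed_iInter fun _ =>
      (isClosed_signedTrapezium p c (k n)).preimage ((differentiable_expSum p).continuous.iterate n)
  obtain ⟨z, hz⟩ := IsCompact.nonempty_iInter_of_sequence_nonempty_isCompact_isClosed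
    (fun N : ℕ => {z : ℂ | ∀ n < N + 1, (expSum p)^[n] z ∈ signedTrapezium p c (k n)})
    (fun N z hz n hn => hz n (by omega))
    (fun N => by
      obtain ⟨z, -, hz⟩ := hfin (N + 1) k hk hY
      exact ⟨z, hz⟩)
    (by
      refine Metric.isCompact_of_isClosed_isBounded (hcl 0) ?_
      refine isBounded_iff_forall_norm_le.2 ⟨c + Y, fun z hz => ?_⟩
      exact (norm_le_of_mem_signedTrapezium hp hM (hk 0) (hY 0) (hz 0 (by omega))).2.2.2)
    hcl
  exact ⟨z, fun n => Set.mem_iInter.1 hz n n (by omega)⟩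

end Coding

/-! ### Membership in the Julia set, and the conclusion. -/

/-- A point with bounded orbit along which the derivatives of the iterates of an entire function
tend to infinity belongs to the Julia set. -/
lemma mem_juliaSet_of_tendsto {f : ℂ → ℂ} (hf : Differentiable ℂ f) {z : ℂ} {R : ℝ}
    (hR : ∀ n, ‖f^[n] z‖ ≤ R) (hd : Tendsto (fun n => ‖deriv f^[n] z‖) atTop atTop) :
    z ∈ juliaSet f := by
  rintro ⟨U, hU, -, hzU, hnorm⟩
  -- A finite locally uniform limit would make the derivatives at z converge; divergence to ∞
  -- contradicts the bounded orbit.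
  obtain ⟨ψ, hψ, ⟨g, hg⟩ | h⟩ := hnorm id
  · have h1 := hg.deriv (Eventually.of_forall fun n => (hf.iterate _).differentiableOn) hU
    have h2 := (h1.tendsto_at hzU).norm
    exact not_tendsto_nhds_of_tendsto_atTop (hd.comp hψ.tendsto_atTop) _ h2
  · obtain ⟨n, hn⟩ := (h {z} (Set.singleton_subset_iff.2 hzU) isCompact_singleton R).exists
    exact absurd (hn z rfl) (not_lt.2 (hR _))

end ExpSum

theorem mainTheorem9 (p : ℕ) (hp : 3 ≤ p) :
    ∃ M₀ : ℕ, 1 ≤ M₀ ∧ ∀ M : ℕ, M₀ ≤ M → ∀ K : ℕ, ∃ c₀ : ℝ, ∀ c : ℝ, c₀ ≤ c →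
      ∀ s ∈ symbolSpace K,
        ∃ z : ℂ,
          -- `z = z(s)` is the unique point of `Λ_K` with itinerary `s`
          (∀ w : ℂ, (w ∈ invariantSet p M K c ∧ HasItinerary p M s w) ↔ w = z) ∧
          (∀ n : ℕ, 1 ≤ n → Function.IsPeriodicPt shift n s →
            IsRepellingPeriodicPt (expSum p) n z ∧
              Function.minimalPeriod (expSum p) z = Function.minimalPeriod shift s) ∧
          z ∈ juliaSet (expSum p) := by
  obtain ⟨m₀, hm₀, hE₀⟩ := exists_isExpandingPiece hp
  -- At depth Mπ/2 the contraction constant is 8π/(Mπ/2) = 16/M, which is at most 1/2 from M = 32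
  -- on.
  refine ⟨max m₀ 32, hm₀.trans (le_max_left _ _), fun M hM K => ?_⟩
  have hM32 : 32 ≤ M := (le_max_right _ _).trans hM
  have hE : ∀ k : ℤ, (M : ℤ) ≤ |k| →
      IsExpandingPiece p (signedHalfStrip p k) (closedSignedHalfStrip p k) := fun k hk =>
    hE₀ k (le_trans (by exact_mod_cast (le_max_left _ _).trans hM) hk)
  set Y := (2 * ((M : ℝ) + K) + 1) * Real.pi with hYdef
  have hY0 : 0 ≤ Y := by have := Real.pi_pos; positivity
  obtain ⟨X, hX0, hX⟩ := exists_forall_norm_sub_exp_le hp Y (ε := 1 / 16) (by norm_num)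
  -- With c ≥ 4 + Y one has c + Y ≤ 2c - 4, which exp(x)/2 exceeds for x > c already by its
  -- quadratic Taylor bound.
  refine ⟨max X (4 + Y), fun c hc s hs => ?_⟩
  have hcX : X ≤ c := (le_max_left _ _).trans hc
  have hc4 : 4 + Y ≤ c := (le_max_right _ _).trans hc
  have hfar : ∀ z : ℂ, |z.im| ≤ Y → c < z.re → c + Y < ‖expSum p z‖ := by
    intro z hz hzc
    have h1 := norm_expSum_ge (hX z hz (hcX.trans hzc.le)).1
    have h2 := Real.quadratic_le_exp_of_nonneg (show 0 ≤ z.re by linarith)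
    nlinarith
  set k : ℕ → ℤ := fun n => stripIndex M (s n) with hkdef
  have habs : ∀ n, |k n| = |s n| + (M - 1) := fun n => abs_stripIndex (by omega) (hs n).1
  have hk : ∀ n, (M : ℤ) ≤ |k n| := fun n => by
    have := (hs n).1
    rw [habs]
    omega
  have hY : ∀ n, (2 * (|k n| : ℤ) + 1) * Real.pi ≤ Y := fun n => by
    have h1 : |k n| ≤ (M : ℤ) + K := by
      have := (hs n).2
      rw [habs]
      omega
    have h2 : ((|k n| : ℤ) : ℝ) ≤ (M : ℝ) + K := by exact_mod_cast h1
    rw [hYdef]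
    gcongr
  obtain ⟨z, hz⟩ := exists_followsTrapezia hp (by omega) hE hk hY (by linarith) hfar
  have hderiv := two_pow_le_norm_deriv_iterate hp hM32 hE hk hz
  -- All periods agree, not just the given one, hence so do the least periods. Forwards, the strip
  -- of an iterate determines its symbol; backwards, fⁿ(z) follows the same sequence as z and
  -- uniqueness applies.
  have hperiod : ∀ n, Function.IsPeriodicPt (expSum p) n z ↔ Function.IsPeriodicPt shift n s := by
    intro n
    constructor
    · intro h
      refine funext fun i => ?_
      rw [shift_iterate_apply]
      refine stripIndex_injOn (M := M) (by omega) (hs _).1 (hs _).1 ?_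
      have h1 := (hz.mem_signedHalfStrip hp (by omega) hE hk (i + n)).1
      rw [Function.iterate_add_apply, h.eq] at h1
      exact eq_of_mem_strip h1 (hz i).1.1 (hz i).1.2.1
    · intro h
      refine FollowsTrapezia.eq hp hM32 hE hk hY (fun i => ?_) hz
      rw [← Function.iterate_add_apply]
      have h1 := hz (i + n)
      have h2 : s (i + n) = s i := by rw [← shift_iterate_apply n s i, h.eq]
      simpa only [hkdef, h2] using h1
  refine ⟨z, fun w => ?_, fun n hn hsn => ⟨⟨hn, (hperiod n).2 hsn, ?_⟩, ?_⟩, ?_⟩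
  · rw [mem_invariantSet_and_hasItinerary_iff hp (by omega) hE hs]
    exact ⟨fun hw => hw.eq hp hM32 hE hk hY hz, fun hw => hw ▸ hz⟩
  · exact (one_lt_pow₀ (by norm_num) (by omega)).trans_le (hderiv n)
  · exact Function.minimalPeriod_eq_minimalPeriod_iff.2 hperiod
  · refine mem_juliaSet_of_tendsto (differentiable_expSum p) (R := c + Y) (fun n =>
      (norm_le_of_mem_signedTrapezium hp (by omega) (hk n) (hY n) (hz n)).2.2.2) ?_
    exact tendsto_atTop_mono hderiv (tendsto_pow_atTop_atTop_of_one_lt (by norm_num))
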